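/- Write $\langle x\rangle=(1+|x|^2)^{1/2}$. Let $\omega\in\mathbb{R}^d$ be diophantine, i.e. there are $c,\mu>0$ such that $|\mathbf n\cdot\omega|>c|\mathbf n|^{-\mu}$ for all $\mathbf n\in\mathbb{Z}^d\setminus\{0\}$, and let $\Theta=\mathbb{Z}^d\cdot\omega=\{\mathbf n\cdot\omega:\mathbf n\in\mathbb{Z}^d\}$. Say that $V\in C^\infty(\mathbb{R};\mathbb{R})$ is an almost periodic coefficient with frequencies $\Theta$ if there are $w_\theta\in C^\infty(\mathbb{R};\mathbb{C})$, $\theta\in\Theta$, with $$V(x)=\sum_{\theta\in\Theta}e^{i\theta x}w_\theta(x)\quad(x\in\mathbb{R}),$$ such that for all integers $k,N\ge 0$ there is $C_{k,N}>0$ with $$|\partial_x^k w_\theta(x)|\le C_{k,N}\langle x\rangle^{-k}\langle\theta\rangle^{-N}\quad(\theta\in\Theta,\ x\in\mathbb{R}),\qquad |\partial_x^k w_{\mathbf n\cdot\omega}(x)|\le C_{k,N}\langle x\rangle^{-k}\langle\mathbf n\rangle^{-N}\quad(\mathbf n\in\mathbb{Z}^d,\ x\in\mathbb{R}).$$ The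 operator $D^2+W_1D+DW_1+W_0$, $D=-i\,d/dx$, satisfies the almost periodic hypotheses if $\omega$ is diophantine and $W_0,W_1$ are almost periodic coefficients with frequencies $\Theta$. Then there is $W\in C^\infty(\mathbb{R};\mathbb{R})$ such that $-\Delta+W$ (that is, $W_1=0$, $W_0=W$) satisfies the almost periodic hypotheses and, for every $\theta\in\Theta\setminus\{0\}$, the number $\theta^2/4$ is an eigenvalue of the operator $-\Delta+W$ on $L^2(\mathbb{R})$ with domain $H^2(\mathbb{R})$. Moreover, if $d\ge 1$, then $W$ can be chosen so that, in addition, this operator has arbitrarily large embedded eigenvalues: for every $M\in\mathbb{R}$ there is an eigenvalue $E>M$ of $-\Delta+W$ lying in its essential spectrum. -/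

import Mathlib

open MeasureTheory Filter Topology
open scoped SchwartzMap Laplacian

noncomputable section

/-! ### Quasi-periodic frequency sets and coefficients -/

/-- The Japanese bracket `⟨x⟩ = (1 + |x|²)^{1/2}`. -/
def japaneseBracket {E : Type*} [Norm E] (x : E) : ℝ := √(1 + ‖x‖ ^ 2)

/-- A vector `n ∈ ℤ^d`, viewed in Euclidean space `ℝ^d`. -/
def latticePoint {d : ℕ} (n : Fin d → ℤ) : EuclideanSpace ℝ (Fin d) :=
  WithLp.toLp 2 fun i => (n i : ℝ)

/-- The frequency `n · ω = ∑ nᵢ ωᵢ`. -/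
def frequency {d : ℕ} (ω : EuclideanSpace ℝ (Fin d)) (n : Fin d → ℤ) : ℝ :=
  ∑ i, (n i : ℝ) * ω i

/-- The frequency set `Θ = ℤ^d · ω`. -/
def frequencySet {d : ℕ} (ω : EuclideanSpace ℝ (Fin d)) : Set ℝ :=
  Set.range (frequency ω)

/-- The diophantine condition: there are `c, μ > 0` with `|n · ω| > c |n|^{-μ}` for all
`n ∈ ℤ^d \ {0}`. -/
def IsDiophantine {d : ℕ} (ω : EuclideanSpace ℝ (Fin d)) : Prop :=
  ∃ c > 0, ∃ μ > 0, ∀ n : Fin d → ℤ, n ≠ 0 →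
    c * ‖latticePoint n‖ ^ (-μ : ℝ) < |frequency ω n|

/-- `V(x) = ∑_{θ ∈ Θ} e^{iθx} w_θ(x)` with smooth `w_θ` such that for all `k, N ≥ 0`,
`|∂ₓᵏ w_θ(x)| ≤ C_{k,N} ⟨x⟩^{-k} ⟨θ⟩^{-N}`. -/
structure HasPotentialForm (Θ : Set ℝ) (V : ℝ → ℝ) (w : Θ → ℝ → ℂ) : Prop where
  contDiff : ∀ θ, ContDiff ℝ (⊤ : ℕ∞) (w θ)
  hasSum : ∀ x : ℝ,
    HasSum (fun θ : Θ => Complex.exp (Complex.I * ((θ : ℝ) : ℂ) * (x : ℂ)) * w θ x) (V x : ℂ)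
  bound : ∀ k N : ℕ, ∃ C > 0, ∀ (θ : Θ) (x : ℝ),
    ‖iteratedDeriv k (w θ) x‖ ≤
      C / (japaneseBracket x ^ k * japaneseBracket (θ : ℝ) ^ N)

/-- A smooth real coefficient of the quasi-periodic class with frequencies `Θ = ℤ^d · ω`: it has
the form `∑_{θ ∈ Θ} e^{iθx} w_θ(x)`, and for all `k, N ≥ 0`,
`|∂ₓᵏ w_{n·ω}(x)| ≤ C_{k,N} ⟨x⟩^{-k} ⟨n⟩^{-N}` for every `n ∈ ℤ^d`. -/
def IsAlmostPeriodicCoefficient {d : ℕ} (ω : EuclideanSpace ℝ (Fin d)) (V : ℝ → ℝ) : Prop :=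
  ContDiff ℝ (⊤ : ℕ∞) V ∧
  ∃ w : frequencySet ω → ℝ → ℂ, HasPotentialForm (frequencySet ω) V w ∧
    ∀ k N : ℕ, ∃ C > 0, ∀ (n : Fin d → ℤ) (x : ℝ),
      ‖iteratedDeriv k (w ⟨frequency ω n, Set.mem_range_self n⟩) x‖ ≤
        C / (japaneseBracket x ^ k * japaneseBracket (latticePoint n) ^ N)

/-- The almost periodic hypotheses on the operator `D² + W₁ D + D W₁ + W₀`, `D = -i d/dx`:
`ω` is diophantine and both coefficients belong to the class with frequencies `ℤ^d · ω`. -/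
structure SatisfiesAlmostPeriodicHypotheses {d : ℕ} (ω : EuclideanSpace ℝ (Fin d))
    (W₁ W₀ : ℝ → ℝ) : Prop where
  diophantine : IsDiophantine ω
  first_order : IsAlmostPeriodicCoefficient ω W₁
  zeroth_order : IsAlmostPeriodicCoefficient ω W₀

/-! ### The Schrödinger operator `-Δ + V` on `L²(ℝ)` -/

/-- The Hilbert space `L²(ℝ)` of complex-valued functions. -/
abbrev L2R : Type := Lp ℂ 2 (volume : Measure ℝ)

theorem L2R.toTemperedDistribution_injective {u v : L2R}
    (h : (u : 𝓢'(ℝ, ℂ)) = (v : 𝓢'(ℝ, ℂ))) : u = v := by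
  have hk := Lp.ker_toTemperedDistributionCLM_eq_bot (F := ℂ) (μ := (volume : Measure ℝ)) (p := 2)
  have := LinearMap.ker_eq_bot.mp hk
  exact this h

/-- The Sobolev space `H²(ℝ)` as a subspace of `L²(ℝ)`. -/
def sobolevH2 : Submodule ℂ L2R where
  carrier := {u | TemperedDistribution.MemSobolev 2 2 (u : 𝓢'(ℝ, ℂ))}
  zero_mem' := by
    have h : ((0 : L2R) : 𝓢'(ℝ, ℂ)) = 0 := by
      rw [← Lp.toTemperedDistributionCLM_apply, map_zero]
    simp [h]
  add_mem' {u v} hu hv := by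
    have h : ((u + v : L2R) : 𝓢'(ℝ, ℂ)) = (u : 𝓢'(ℝ, ℂ)) + (v : 𝓢'(ℝ, ℂ)) := by
      simp only [← Lp.toTemperedDistributionCLM_apply, map_add]
    simpa only [Set.mem_ofPred_eq, h] using hu.add hv
  smul_mem' c u hu := by
    have h : ((c • u : L2R) : 𝓢'(ℝ, ℂ)) = c • (u : 𝓢'(ℝ, ℂ)) := by
      simp only [← Lp.toTemperedDistributionCLM_apply, map_smul]
    simpa only [Set.mem_ofPred_eq, h] using
      TemperedDistribution.MemSobolev.smul c hu

theorem exists_laplacian_of_mem_sobolevH2 {u : L2R} (hu : u ∈ sobolevH2) :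
    ∃ v : L2R, Δ (u : 𝓢'(ℝ, ℂ)) = (v : 𝓢'(ℝ, ℂ)) := by
  have h := TemperedDistribution.MemSobolev.laplacian
    (show TemperedDistribution.MemSobolev 2 2 (u : 𝓢'(ℝ, ℂ)) from hu)
  rw [sub_self] at h
  exact TemperedDistribution.memSobolev_zero_iff.mp h

/-- `u ∈ L²(ℝ)` belongs to `H²(ℝ)` if and only if its distributional Laplacian is in `L²(ℝ)`. -/
theorem mem_sobolevH2_iff {u : L2R} :
    u ∈ sobolevH2 ↔ ∃ v : L2R, Δ (u : 𝓢'(ℝ, ℂ)) = (v : 𝓢'(ℝ, ℂ)) := by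
  refine ⟨exists_laplacian_of_mem_sobolevH2, fun ⟨v, hv⟩ => ?_⟩
  have key : TemperedDistribution.besselPotential ℝ ℂ 2 (u : 𝓢'(ℝ, ℂ)) =
      (u : 𝓢'(ℝ, ℂ)) - (((2 * Real.pi) ^ 2)⁻¹ : ℝ) • Δ (u : 𝓢'(ℝ, ℂ)) := by
    have hg : (fun x : ℝ => Complex.ofReal ((1 + ‖x‖ ^ 2) ^ ((2 : ℝ) / 2))) =
        (fun _ => (1 : ℂ)) + fun x => Complex.ofReal (‖x‖ ^ 2) := by
      ext x
      simp
    have h1 : (fun x : ℝ => Complex.ofReal (‖x‖ ^ 2)).HasTemperateGrowth := by fun_prop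
    have h2 : (fun _ : ℝ => (1 : ℂ)).HasTemperateGrowth := by fun_prop
    have hM : TemperedDistribution.besselPotential ℝ ℂ 2 (u : 𝓢'(ℝ, ℂ)) = (u : 𝓢'(ℝ, ℂ)) +
        TemperedDistribution.fourierMultiplierCLM ℂ (fun x : ℝ => Complex.ofReal (‖x‖ ^ 2))
          (u : 𝓢'(ℝ, ℂ)) := by
      rw [TemperedDistribution.besselPotential, hg,
        TemperedDistribution.fourierMultiplierCLM_apply,
        TemperedDistribution.smulLeftCLM_add h2 h1, add_apply,
        FourierTransform.fourierInv_add, TemperedDistribution.smulLeftCLM_const, one_smul,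
        FourierTransform.fourierInv_fourier_eq, TemperedDistribution.fourierMultiplierCLM_apply]
    rw [hM, TemperedDistribution.laplacian_eq_fourierMultiplierCLM, smul_smul]
    have hc : ((2 * Real.pi) ^ 2)⁻¹ * -(2 * Real.pi) ^ 2 = -1 := by
      field_simp
    rw [hc, neg_one_smul, sub_neg_eq_add]
  refine ⟨u - ((((2 * Real.pi) ^ 2)⁻¹ : ℝ) : ℂ) • v, ?_⟩
  rw [key, hv]
  simp only [← Lp.toTemperedDistributionCLM_apply, map_sub, map_smul]
  rfl

/-- The Laplacian `Δ = d²/dx²` (in the sense of distributions) as an unbounded operator on `L²(ℝ)`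
with domain `H²(ℝ)`. -/
def laplacianL2 : L2R →ₗ.[ℂ] L2R where
  domain := sobolevH2
  toFun :=
    { toFun := fun u => (exists_laplacian_of_mem_sobolevH2 u.2).choose
      map_add' := fun u v => by
        apply L2R.toTemperedDistribution_injective
        have h1 := (exists_laplacian_of_mem_sobolevH2 (u + v).2).choose_spec
        have h2 := (exists_laplacian_of_mem_sobolevH2 u.2).choose_spec
        have h3 := (exists_laplacian_of_mem_sobolevH2 v.2).choose_spec
        rw [← h1]
        simp only [← Lp.toTemperedDistributionCLM_apply, map_add] at h2 h3 ⊢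
        rw [← h2, ← h3]
        simp only [Submodule.coe_add, map_add, ← TemperedDistribution.laplacianCLM_apply]
      map_smul' := fun c u => by
        apply L2R.toTemperedDistribution_injective
        have h1 := (exists_laplacian_of_mem_sobolevH2 (c • u).2).choose_spec
        have h2 := (exists_laplacian_of_mem_sobolevH2 u.2).choose_spec
        rw [← h1]
        simp only [← Lp.toTemperedDistributionCLM_apply, map_smul, RingHom.id_apply] at h2 ⊢
        rw [← h2]
        simp only [Submodule.coe_smul, map_smul, ← TemperedDistribution.laplacianCLM_apply] }

theorem laplacianL2_spec (u : laplacianL2.domain) :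
    ((laplacianL2 u : L2R) : 𝓢'(ℝ, ℂ)) = Δ ((u : L2R) : 𝓢'(ℝ, ℂ)) :=
  (exists_laplacian_of_mem_sobolevH2 u.2).choose_spec.symm

/-- The operator of multiplication by `V` on `L²(ℝ)` with its maximal domain
`{u ∈ L² : V u ∈ L²}`. -/
def multiplicationL2 (V : ℝ → ℝ) : L2R →ₗ.[ℂ] L2R where
  domain :=
    { carrier := {u | MemLp (fun x => (V x : ℂ) * u x) 2 (volume : Measure ℝ)}
      zero_mem' := by
        refine (MemLp.zero : MemLp (0 : ℝ → ℂ) 2 (volume : Measure ℝ)).ae_eq ?_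
        filter_upwards [Lp.coeFn_zero ℂ 2 (volume : Measure ℝ)] with x hx
        rw [hx, Pi.zero_apply, mul_zero]
      add_mem' := fun {u v} hu hv => by
        refine (MemLp.add hu hv).ae_eq ?_
        filter_upwards [Lp.coeFn_add u v] with x hx
        rw [hx, Pi.add_apply, Pi.add_apply, mul_add]
      smul_mem' := fun c u hu => by
        refine (MemLp.const_smul hu c).ae_eq ?_
        filter_upwards [Lp.coeFn_smul c u] with x hx
        simp only [Pi.smul_apply, hx, smul_eq_mul]
        ring }
  toFun :=
    { toFun := fun u => MemLp.toLp (fun x => (V x : ℂ) * (u : L2R) x) u.2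
      map_add' := fun u v => by
        rw [← MemLp.toLp_add]
        refine MemLp.toLp_congr _ _ ?_
        filter_upwards [Lp.coeFn_add (u : L2R) (v : L2R)] with x hx
        rw [Submodule.coe_add, hx, Pi.add_apply, Pi.add_apply, mul_add]
      map_smul' := fun c u => by
        rw [RingHom.id_apply, ← MemLp.toLp_const_smul]
        refine MemLp.toLp_congr _ _ ?_
        filter_upwards [Lp.coeFn_smul c (u : L2R)] with x hx
        simp only [Submodule.coe_smul, Pi.smul_apply, hx, smul_eq_mul]
        ring }

/-- The Schrödinger operator `-Δ + V` on `L²(ℝ)`, with domain `H²(ℝ) ∩ {u : V u ∈ L²}`, which is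
`H²(ℝ)` when `V` is bounded. -/
def schrodingerOperator (V : ℝ → ℝ) : L2R →ₗ.[ℂ] L2R :=
  -laplacianL2 + multiplicationL2 V

/-! ### Spectral notions for unbounded operators -/

section Spectrum

variable {H : Type*} [NormedAddCommGroup H] [InnerProductSpace ℂ H]

/-- The point spectrum (set of eigenvalues) of an unbounded operator. -/
def pointSpectrum (T : H →ₗ.[ℂ] H) : Set ℂ :=
  {E | ∃ u : T.domain, (u : H) ≠ 0 ∧ T u = E • (u : H)}

/-- The essential spectrum of a self-adjoint operator: the set of `E` having a singular Weyl
sequence, i.e. an orthonormal sequence `uₙ` in the domain with `‖(T - E) uₙ‖ → 0`. -/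
def essentialSpectrum (T : H →ₗ.[ℂ] H) : Set ℂ :=
  {E | ∃ u : ℕ → T.domain, Orthonormal ℂ (fun n => (u n : H)) ∧
    Tendsto (fun n => ‖T (u n) - E • (u n : H)‖) atTop (𝓝 0)}

/-- The embedded eigenvalues of a self-adjoint operator: those lying in the essential spectrum. -/
def embeddedEigenvalues (T : H →ₗ.[ℂ] H) : Set ℂ :=
  pointSpectrum T ∩ essentialSpectrum T

end Spectrum

end

/-! The eigenvalues `κ² = θ² / 4` are embedded by the Wigner–von Neumann mechanism: a potential of
size `1 / x` oscillating at the frequency `2κ = θ`, with the right phase, makes a solution of energy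
`κ²` decay like a power of `x`.

The half-line is divided into the blocks `[4^j, 4^(j+1)]`. On the `j`-th block the potential is
`a_j(x) ∑ cₙ cos (2 κₙ x + φ_{j,n})`, where `a_j(x) = 4⁻ʲ β(4⁻ʲ x)` for a fixed bump function `β`,
and where only finitely many `n` are active, more and more of them as `j` grows; the potential is
extended evenly to the whole line. The phases may jump from one block to the next without any harm
to the symbol estimates, since the blocks have disjoint supports and lengths comparable to their
distance from the origin. Hence there is no self-consistency problem: entering the `j`-th block, each
active `φ_{j,n}` is tuned to the current Prüfer angle of the solution of energy `κₙ²` that vanishes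
at the origin, and this angle depends on the earlier blocks only (`exists_tuned_phases`). Thus all
energies are treated simultaneously.

On a single block (`IsPruferAngle.logAmplitude_sub_le_of_resonant`), the logarithm of the Prüfer
amplitude at energy `κₘ²` changes by the resonant term `-(cₘ / 4 κₘ) ∫ a_j = -4`, up to oscillatory
integrals, which are small by non-stationary phase (`abs_integral_mul_cos_le`). The tuned phase is
an unstable equilibrium, but the instability is amplified only by a constant factor on each block
(`abs_le_of_hasDerivAt_sin`). The small denominators `κₙ - κₘ` are harmless because the `n`-th energy
is activated only from the block number `K n` on, which may be as late as one likes (`exists_isDelay`). So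
the amplitude decreases at least by `e⁻³` on every late block, hence like `1 / (1 + x²)`
(`exists_exp_logAmplitude_le`), and evenness of the potential gives the same on the left half-line.

The late activation also makes the coefficient of `e^{± 2 i κₙ x}` exponentially small in `K n`, which
dominates the lattice point of the frequency `2 κₙ`
(`isAlmostPeriodicCoefficient_blockSumPotential`). Finally, the potential vanishes on the intervals
`[2 · 4^j, 4 · 4^j]`, and wave packets living there are a singular Weyl sequence at every energy
`κ²` (`mem_essentialSpectrum_of_gaps`), so all these eigenvalues are embedded. -/

/-! ### Classical functions in the domain of the Schrödinger operator -/

theorem SchwartzMap.laplacian_apply_eq_deriv_deriv (g : 𝓢(ℝ, ℂ)) (x : ℝ) :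
    (Δ g) x = deriv (deriv g) x := by
  rw [SchwartzMap.laplacian_apply]
  simp [InnerProductSpace.laplacian_eq_iteratedDeriv_real, iteratedDeriv_succ]

theorem SchwartzMap.integrable_mul_of_bounded (g : 𝓢(ℝ, ℂ)) {f : ℝ → ℂ}
    (hf : AEStronglyMeasurable f volume) {C : ℝ} (hC : ∀ x, ‖f x‖ ≤ C) :
    Integrable (fun x => g x * f x) :=
  g.integrable.mul_bdd hf (ae_of_all _ hC)

/-- Integrating by parts twice: no boundary terms appear because `g` is a Schwartz function. -/
theorem integral_laplacian_mul_eq {f f' f'' : ℝ → ℂ} (hf : ∀ x, HasDerivAt f (f' x) x)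
    (hf' : ∀ x, HasDerivAt f' (f'' x) x) (hm : AEStronglyMeasurable f'' volume) {C : ℝ}
    (h0 : ∀ x, ‖f x‖ ≤ C) (h1 : ∀ x, ‖f' x‖ ≤ C) (h2 : ∀ x, ‖f'' x‖ ≤ C) (g : 𝓢(ℝ, ℂ)) :
    ∫ x, (Δ g) x * f x = ∫ x, g x * f'' x := by
  have c0 : Continuous f := continuous_iff_continuousAt.2 fun x => (hf x).continuousAt
  have c1 : Continuous f' := continuous_iff_continuousAt.2 fun x => (hf' x).continuousAt
  set g' : 𝓢(ℝ, ℂ) := SchwartzMap.derivCLM ℂ ℂ g with hg'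
  set g'' : 𝓢(ℝ, ℂ) := SchwartzMap.derivCLM ℂ ℂ g' with hg''
  have d0 : ∀ x, HasDerivAt g (g' x) x := fun x => by
    simpa [hg'] using g.hasDerivAt x
  have d1 : ∀ x, HasDerivAt g' (g'' x) x := fun x => by
    simpa [hg''] using g'.hasDerivAt x
  have e : ∀ x, (Δ g) x = g'' x := fun x => by
    rw [SchwartzMap.laplacian_apply_eq_deriv_deriv, (funext fun x => (d0 x).deriv : deriv g = g'),
      (d1 x).deriv]
  have I (h : 𝓢(ℝ, ℂ)) {f : ℝ → ℂ} (hm : AEStronglyMeasurable f volume)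
      (hC : ∀ x, ‖f x‖ ≤ C) : Integrable (f * ⇑h) := by
    simpa [mul_comm, Pi.mul_def] using h.integrable_mul_of_bounded hm hC
  have p1 := integral_mul_deriv_eq_deriv_mul_of_integrable (fun x _ => hf x) (fun x _ => d1 x)
    (I g'' c0.aestronglyMeasurable h0) (I g' c1.aestronglyMeasurable h1)
    (I g' c0.aestronglyMeasurable h0)
  have p2 := integral_mul_deriv_eq_deriv_mul_of_integrable (fun x _ => hf' x) (fun x _ => d0 x)
    (I g' c1.aestronglyMeasurable h1) (I g hm h2) (I g c1.aestronglyMeasurable h1)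
  simp_rw [e, mul_comm _ (f _), mul_comm _ (f'' _)]
  rw [p1, p2, neg_neg]

/-- On bounded `C²` functions with enough square integrability the operator `-Δ + V` acts in the
classical way. -/
theorem exists_schrodingerOperator_eq {V : ℝ → ℝ} (hV : Continuous V) {M : ℝ}
    (hM : ∀ x, |V x| ≤ M) {f f' f'' : ℝ → ℂ} (hf : ∀ x, HasDerivAt f (f' x) x)
    (hf' : ∀ x, HasDerivAt f' (f'' x) x) {C : ℝ}
    (h0 : ∀ x, ‖f x‖ ≤ C) (h1 : ∀ x, ‖f' x‖ ≤ C) (h2 : ∀ x, ‖f'' x‖ ≤ C)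
    (hL : MemLp f 2 volume) (hL'' : MemLp f'' 2 volume) :
    ∃ u : (schrodingerOperator V).domain, (u : L2R) = hL.toLp f ∧
      schrodingerOperator V u =ᵐ[volume] fun x => -f'' x + V x * f x := by
  have hdist : Δ ((hL.toLp f : L2R) : 𝓢'(ℝ, ℂ)) = ((hL''.toLp f'' : L2R) : 𝓢'(ℝ, ℂ)) := by
    ext g
    rw [TemperedDistribution.laplacian_apply_apply, Lp.toTemperedDistribution_apply,
      Lp.toTemperedDistribution_apply]
    have a1 : ∫ x, (Δ g) x • (hL.toLp f : L2R) x = ∫ x, (Δ g) x * f x :=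
      integral_congr_ae (by filter_upwards [hL.coeFn_toLp] with x hx; rw [hx, smul_eq_mul])
    have a2 : ∫ x, g x • (hL''.toLp f'' : L2R) x = ∫ x, g x * f'' x :=
      integral_congr_ae (by filter_upwards [hL''.coeFn_toLp] with x hx; rw [hx, smul_eq_mul])
    rw [a1, a2]
    exact integral_laplacian_mul_eq hf hf' hL''.1 h0 h1 h2 g
  have m1 : (hL.toLp f : L2R) ∈ laplacianL2.domain := mem_sobolevH2_iff.2 ⟨_, hdist⟩
  have hVf : MemLp (fun x => (V x : ℂ) * f x) 2 volume := by
    refine MemLp.of_le_mul (c := M) hL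
      ((Complex.continuous_ofReal.comp hV).aestronglyMeasurable.mul hL.1) (ae_of_all _ fun x => ?_)
    rw [norm_mul, Complex.norm_real]
    exact mul_le_mul_of_nonneg_right (hM x) (norm_nonneg _)
  have m2 : (hL.toLp f : L2R) ∈ (multiplicationL2 V).domain := by
    refine hVf.ae_eq ?_
    filter_upwards [hL.coeFn_toLp] with x hx
    rw [hx]
  refine ⟨⟨hL.toLp f, ⟨m1, m2⟩⟩, rfl, ?_⟩
  have hlap : laplacianL2 ⟨hL.toLp f, m1⟩ = hL''.toLp f'' := by
    apply L2R.toTemperedDistribution_injective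
    rw [laplacianL2_spec, hdist]
  have hmul : multiplicationL2 V ⟨hL.toLp f, m2⟩ =ᵐ[volume] fun x => (V x : ℂ) * f x := by
    refine (MemLp.coeFn_toLp m2).trans ?_
    filter_upwards [hL.coeFn_toLp] with x hx
    rw [hx]
  have hsum : schrodingerOperator V ⟨hL.toLp f, ⟨m1, m2⟩⟩ =
      -laplacianL2 ⟨hL.toLp f, m1⟩ + multiplicationL2 V ⟨hL.toLp f, m2⟩ := rfl
  rw [hsum, hlap]
  filter_upwards [Lp.coeFn_add (-(hL''.toLp f'' : L2R)) (multiplicationL2 V ⟨hL.toLp f, m2⟩),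
    Lp.coeFn_neg (hL''.toLp f'' : L2R), hL''.coeFn_toLp, hmul] with x e1 e2 e3 e4
  rw [e1, Pi.add_apply, e2, Pi.neg_apply, e3, e4]

/-! ### Prüfer variables -/

/-- `θ` is the Prüfer angle, vanishing at the origin, of the equation `-u'' + V u = κ² u`:
a solution is written as `u = R sin θ`, `u' = κ R cos θ`. -/
structure IsPruferAngle (V : ℝ → ℝ) (κ : ℝ) (θ : ℝ → ℝ) : Prop where
  zero : θ 0 = 0
  hasDerivAt : ∀ x, HasDerivAt θ (κ - V x / κ * Real.sin (θ x) ^ 2) x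

/-- The logarithm of the Prüfer amplitude, normalized to vanish at the origin. -/
noncomputable def logAmplitude (V : ℝ → ℝ) (κ : ℝ) (θ : ℝ → ℝ) (x : ℝ) : ℝ :=
  ∫ t in (0 : ℝ)..x, V t / (2 * κ) * Real.sin (2 * θ t)

open scoped NNReal in
theorem lipschitzWith_pruferField {V : ℝ → ℝ} {M : ℝ≥0} (hM : ∀ x, |V x| ≤ M) (κ t : ℝ) :
    LipschitzWith (M / ‖κ‖₊ * 2) fun y => κ - V t / κ * Real.sin y ^ 2 := by
  refine lipschitzWith_of_nnnorm_deriv_le (by fun_prop) fun y => ?_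
  have h : deriv (fun y => κ - V t / κ * Real.sin y ^ 2) y =
      -(V t / κ * (2 * Real.sin y * Real.cos y)) := by
    have := (((Real.hasDerivAt_sin y).pow 2).const_mul (V t / κ)).const_sub κ
    refine (this.congr_deriv ?_).deriv
    simp
  rw [h, ← NNReal.coe_le_coe]
  simp only [coe_nnnorm, NNReal.coe_mul, NNReal.coe_div, norm_neg, norm_mul, norm_div,
    Real.norm_eq_abs, NNReal.coe_ofNat, abs_two]
  have h1 := Real.abs_sin_le_one y
  have h2 := Real.abs_cos_le_one y
  have h3 : 2 * |Real.sin y| * |Real.cos y| ≤ 2 := by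
    nlinarith [abs_nonneg (Real.sin y), abs_nonneg (Real.cos y)]
  gcongr
  exact hM t

open scoped NNReal in
/-- Causality: the Prüfer angle on `[0, b]` depends only on the potential there. -/
theorem IsPruferAngle.eqOn_Icc {V W : ℝ → ℝ} {κ b : ℝ} {θ η : ℝ → ℝ} (hθ : IsPruferAngle V κ θ)
    (hη : IsPruferAngle W κ η) {M : ℝ} (hM : ∀ x, |V x| ≤ M)
    (hVW : ∀ x ∈ Set.Ico 0 b, V x = W x) : Set.EqOn θ η (Set.Icc 0 b) := by
  lift M to ℝ≥0 using (abs_nonneg _).trans (hM 0)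
  refine ODE_solution_unique (v := fun t y => κ - V t / κ * Real.sin y ^ 2)
    (lipschitzWith_pruferField hM κ)
    (fun x _ => (hθ.hasDerivAt x).continuousAt.continuousWithinAt)
    (fun x _ => (hθ.hasDerivAt x).hasDerivWithinAt)
    (fun x _ => (hη.hasDerivAt x).continuousAt.continuousWithinAt)
    (fun x hx => ?_) (by rw [hθ.zero, hη.zero])
  simpa only [hVW x hx] using (hη.hasDerivAt x).hasDerivWithinAt

open scoped NNReal in
/-- For an even potential the Prüfer angle vanishing at the origin is odd. -/
theorem IsPruferAngle.odd {V : ℝ → ℝ} {κ : ℝ} {θ : ℝ → ℝ} (hθ : IsPruferAngle V κ θ)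
    (hV : ∀ x, V (-x) = V x) {M : ℝ} (hM : ∀ x, |V x| ≤ M) (x : ℝ) : θ (-x) = -θ x := by
  lift M to ℝ≥0 using (abs_nonneg _).trans (hM 0)
  have key : θ = fun x => -θ (-x) := by
    refine ODE_solution_unique_univ (v := fun t y => κ - V t / κ * Real.sin y ^ 2)
      (s := fun _ => Set.univ) (t₀ := 0)
      (fun t => (lipschitzWith_pruferField hM κ t).lipschitzOnWith)
      (fun t => ⟨hθ.hasDerivAt t, trivial⟩) (fun t => ⟨?_, trivial⟩) (by simp [hθ.zero])
    have := ((hθ.hasDerivAt (-t)).scomp t (hasDerivAt_neg t)).neg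
    simpa [hV, Function.comp_def, Pi.neg_def] using this
  have := congrFun key x
  linarith

open scoped NNReal in
/-- The right-hand side of the angle equation is bounded and Lipschitz, so that the
Picard–Lindelöf theorem applies on every interval `[-T, T]`; uniqueness glues the solutions. -/
theorem exists_isPruferAngle {V : ℝ → ℝ} (hV : Continuous V) {M : ℝ} (hM : ∀ x, |V x| ≤ M)
    (κ : ℝ) : ∃ θ, IsPruferAngle V κ θ := by
  lift M to ℝ≥0 using (abs_nonneg _).trans (hM 0)
  set v : ℝ → ℝ → ℝ := fun t y => κ - V t / κ * Real.sin y ^ 2 with hv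
  have hlip := lipschitzWith_pruferField hM κ
  have hbound : ∀ t y, ‖v t y‖ ≤ ‖κ‖₊ + M / ‖κ‖₊ := fun t y => by
    have h1 := Real.abs_sin_le_one y
    have h2 : |Real.sin y| ^ 2 ≤ 1 := pow_le_one₀ (abs_nonneg _) h1
    calc ‖v t y‖ ≤ ‖κ‖ + ‖V t / κ * Real.sin y ^ 2‖ := norm_sub_le _ _
      _ ≤ ‖κ‖₊ + M / ‖κ‖₊ := by
        simp only [norm_mul, norm_div, norm_pow, Real.norm_eq_abs, coe_nnnorm]
        have := hM t
        gcongr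
        calc |V t| / |κ| * |Real.sin y| ^ 2 ≤ |V t| / |κ| * 1 := by gcongr
          _ ≤ M / |κ| := by rw [mul_one]; gcongr
  have hloc : ∀ T : ℝ≥0, ∃ θ : ℝ → ℝ, θ 0 = 0 ∧
      ∀ t ∈ Set.Icc (-T : ℝ) T, HasDerivWithinAt θ (v t (θ t)) (Set.Icc (-T : ℝ) T) t := by
    intro T
    have hPL : IsPicardLindelof v (tmin := -T) (tmax := T) ⟨0, by simp⟩ 0
        ((‖κ‖₊ + M / ‖κ‖₊) * T) 0 (‖κ‖₊ + M / ‖κ‖₊) (M / ‖κ‖₊ * 2) :=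
      { lipschitzOnWith := fun t _ => (hlip t).lipschitzOnWith
        continuousOn := fun y _ => Continuous.continuousOn (by fun_prop)
        norm_le := fun t _ y _ => by simpa using hbound t y
        mul_max_le := by simp }
    simpa using hPL.exists_eq_forall_mem_Icc_hasDerivWithinAt₀
  choose θ hθ0 hθ using hloc
  have hd : ∀ T : ℝ≥0, ∀ t ∈ Set.Ioo (-T : ℝ) T, HasDerivAt (θ T) (v t (θ T t)) t :=
    fun T t ht => (hθ T t (Set.Ioo_subset_Icc_self ht)).hasDerivAt (Icc_mem_nhds ht.1 ht.2)
  have huniq : ∀ S T : ℝ≥0, S ≤ T → Set.EqOn (θ S) (θ T) (Set.Ioo (-S : ℝ) S) := by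
    intro S T hST t ht
    have hS : (0 : ℝ) < S := by linarith [ht.1, ht.2]
    have hST' : (S : ℝ) ≤ T := hST
    exact ODE_solution_unique_of_mem_Ioo (v := v) (s := fun _ => Set.univ) (t₀ := 0)
      (fun t _ => (hlip t).lipschitzOnWith) ⟨by linarith, hS⟩
      (fun t ht => ⟨hd S t ht, trivial⟩)
      (fun t ht => ⟨hd T t ⟨by linarith [ht.1], by linarith [ht.2]⟩, trivial⟩)
      (by rw [hθ0, hθ0]) ht
  refine ⟨fun x => θ (‖x‖₊ + 1) x, hθ0 _, fun x => ?_⟩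
  have hmem : x ∈ Set.Ioo (-((‖x‖₊ + 1 : ℝ≥0) : ℝ)) (‖x‖₊ + 1 : ℝ≥0) := by
    simp only [NNReal.coe_add, coe_nnnorm, Real.norm_eq_abs, NNReal.coe_one]
    exact ⟨by linarith [neg_abs_le x], by linarith [le_abs_self x]⟩
  refine (hd _ x hmem).congr_of_eventuallyEq ?_
  filter_upwards [isOpen_Ioo.mem_nhds hmem] with y hy
  have hmem' : y ∈ Set.Ioo (-((‖y‖₊ + 1 : ℝ≥0) : ℝ)) (‖y‖₊ + 1 : ℝ≥0) := by
    simp only [NNReal.coe_add, coe_nnnorm, Real.norm_eq_abs, NNReal.coe_one]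
    exact ⟨by linarith [neg_abs_le y], by linarith [le_abs_self y]⟩
  rcases le_total (‖y‖₊ + 1) (‖x‖₊ + 1) with h | h
  · exact huniq _ _ h hmem'
  · exact (huniq _ _ h hy).symm

section

variable {V : ℝ → ℝ} {κ : ℝ} {θ : ℝ → ℝ}

theorem IsPruferAngle.continuous (hθ : IsPruferAngle V κ θ) : Continuous θ :=
  continuous_iff_continuousAt.2 fun x => (hθ.hasDerivAt x).continuousAt

theorem IsPruferAngle.hasDerivAt_logAmplitude (hθ : IsPruferAngle V κ θ) (hV : Continuous V)
    (x : ℝ) :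
    HasDerivAt (logAmplitude V κ θ) (V x / (2 * κ) * Real.sin (2 * θ x)) x := by
  have := hθ.continuous
  exact intervalIntegral.integral_hasDerivAt_right
    (Continuous.intervalIntegrable (by fun_prop) _ _)
    (Continuous.stronglyMeasurableAtFilter (by fun_prop) _ _)
    (Continuous.continuousAt (by fun_prop))

theorem IsPruferAngle.logAmplitude_neg (hθ : IsPruferAngle V κ θ)
    (hV : ∀ x, V (-x) = V x) {M : ℝ} (hM : ∀ x, |V x| ≤ M) (x : ℝ) :
    logAmplitude V κ θ (-x) = logAmplitude V κ θ x := by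
  unfold logAmplitude
  rw [← neg_zero, ← intervalIntegral.integral_comp_neg, intervalIntegral.integral_symm, neg_zero,
    ← intervalIntegral.integral_neg]
  simp [hV, hθ.odd hV hM]

/-- The solution of `-u'' + V u = κ² u` recovered from its Prüfer variables. -/
noncomputable def pruferSolution (V : ℝ → ℝ) (κ : ℝ) (θ : ℝ → ℝ) (x : ℝ) : ℝ :=
  Real.exp (logAmplitude V κ θ x) * Real.sin (θ x)

/-- The derivative of the solution recovered from its Prüfer variables. -/
noncomputable def pruferDerivative (V : ℝ → ℝ) (κ : ℝ) (θ : ℝ → ℝ) (x : ℝ) : ℝ :=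
  κ * (Real.exp (logAmplitude V κ θ x) * Real.cos (θ x))

theorem IsPruferAngle.hasDerivAt_pruferSolution (hθ : IsPruferAngle V κ θ) (hV : Continuous V)
    (hκ : κ ≠ 0) (x : ℝ) :
    HasDerivAt (pruferSolution V κ θ) (pruferDerivative V κ θ x) x := by
  have h := ((hθ.hasDerivAt_logAmplitude hV x).exp).mul (hθ.hasDerivAt x).sin
  refine h.congr_deriv ?_
  rw [pruferDerivative, Real.sin_two_mul]
  field_simp
  ring

theorem IsPruferAngle.hasDerivAt_pruferDerivative (hθ : IsPruferAngle V κ θ) (hV : Continuous V)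
    (hκ : κ ≠ 0) (x : ℝ) :
    HasDerivAt (pruferDerivative V κ θ) ((V x - κ ^ 2) * pruferSolution V κ θ x) x := by
  have h := (((hθ.hasDerivAt_logAmplitude hV x).exp).mul (hθ.hasDerivAt x).cos).const_mul κ
  refine h.congr_deriv ?_
  rw [pruferSolution, Real.sin_two_mul]
  have := Real.sin_sq_add_cos_sq (θ x)
  field_simp
  linear_combination (V x * Real.sin (θ x)) * this

end

/-! ### Resonance on a single block -/

/-- Non-stationary phase: if the derivative of the phase `ψ` stays within `ε` of the nonzero
constant `δ`, one integration by parts gains a factor `|δ|⁻¹`. -/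
theorem abs_integral_mul_cos_le {a a' ψ ψ' : ℝ → ℝ} {p q δ A A' ε : ℝ} (hpq : p ≤ q)
    (ha : ∀ x, HasDerivAt a (a' x) x) (hψ : ∀ x, HasDerivAt ψ (ψ' x) x)
    (ca' : Continuous a') (cψ' : Continuous ψ') (hδ : δ ≠ 0)
    (bA : ∀ x ∈ Set.Icc p q, |a x| ≤ A) (bA' : ∀ x ∈ Set.Icc p q, |a' x| ≤ A')
    (bψ : ∀ x ∈ Set.Icc p q, |ψ' x - δ| ≤ ε) :
    |∫ x in p..q, a x * Real.cos (ψ x)| ≤ (2 * A + (A' + A * ε) * (q - p)) / |δ| := by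
  have ca : Continuous a := continuous_iff_continuousAt.2 fun x => (ha x).continuousAt
  have cψ : Continuous ψ := continuous_iff_continuousAt.2 fun x => (hψ x).continuousAt
  have hFTC : ∫ x in p..q, (a' x * Real.sin (ψ x) + a x * (Real.cos (ψ x) * ψ' x)) =
      a q * Real.sin (ψ q) - a p * Real.sin (ψ p) :=
    intervalIntegral.integral_eq_sub_of_hasDerivAt (fun x _ => (ha x).mul (hψ x).sin)
      (Continuous.intervalIntegrable (by fun_prop) _ _)
  have hsplit : δ * ∫ x in p..q, a x * Real.cos (ψ x) =
      (a q * Real.sin (ψ q) - a p * Real.sin (ψ p)) -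
        ∫ x in p..q, (a' x * Real.sin (ψ x) + a x * ((ψ' x - δ) * Real.cos (ψ x))) := by
    rw [← hFTC, ← intervalIntegral.integral_sub, ← intervalIntegral.integral_const_mul]
    · congr 1; ext x; ring
    all_goals exact Continuous.intervalIntegrable (by fun_prop) _ _
  have hrest : |∫ x in p..q, (a' x * Real.sin (ψ x) + a x * ((ψ' x - δ) * Real.cos (ψ x)))| ≤
      (A' + A * ε) * (q - p) := by
    have := intervalIntegral.norm_integral_le_of_norm_le_const (a := p) (b := q)
      (f := fun x => a' x * Real.sin (ψ x) + a x * ((ψ' x - δ) * Real.cos (ψ x)))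
      (C := A' + A * ε) fun x hx => ?_
    · rwa [abs_of_nonneg (sub_nonneg.2 hpq)] at this
    rw [Set.uIoc_of_le hpq] at hx
    have hx' : x ∈ Set.Icc p q := Set.Ioc_subset_Icc_self hx
    have hA : 0 ≤ A := (abs_nonneg _).trans (bA x hx')
    refine (norm_add_le _ _).trans ?_
    simp only [norm_mul, Real.norm_eq_abs]
    refine add_le_add ?_ ?_
    · exact (mul_le_of_le_one_right (abs_nonneg _) (Real.abs_sin_le_one _)).trans (bA' x hx')
    · exact mul_le_mul (bA x hx') ((mul_le_of_le_one_right (abs_nonneg _)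
        (Real.abs_cos_le_one _)).trans (bψ x hx')) (by positivity) hA
  have hbd : ∀ x ∈ Set.Icc p q, |a x * Real.sin (ψ x)| ≤ A := fun x hx => by
    rw [abs_mul]
    exact (mul_le_of_le_one_right (abs_nonneg _) (Real.abs_sin_le_one _)).trans (bA x hx)
  rw [le_div_iff₀ (abs_pos.2 hδ), mul_comm, ← abs_mul, hsplit]
  have h1 := abs_le.1 (hbd p ⟨le_rfl, hpq⟩)
  have h2 := abs_le.1 (hbd q ⟨hpq, le_rfl⟩)
  have h3 := abs_le.1 hrest
  rw [abs_le]
  constructor <;> linarith [h1.1, h1.2, h2.1, h2.2, h3.1, h3.2]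

/-- Grönwall's inequality for `η' = g sin η + o`, where the forcing `o` has a small primitive `Q`:
the unstable equilibrium `η = 0` is left only by the amount `sup |Q|`, amplified by the exponential
of the length of the interval times `sup |g|`. -/
theorem abs_le_of_hasDerivAt_sin {η Q g o : ℝ → ℝ} {p q G E : ℝ} (hG : 0 < G)
    (hη : ∀ x ∈ Set.Icc p q, HasDerivAt η (g x * Real.sin (η x) + o x) x)
    (hQ : ∀ x ∈ Set.Icc p q, HasDerivAt Q (o x) x) (h0 : η p = 0) (hQ0 : Q p = 0)
    (bg : ∀ x ∈ Set.Icc p q, |g x| ≤ G) (bQ : ∀ x ∈ Set.Icc p q, |Q x| ≤ E) :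
    ∀ x ∈ Set.Icc p q, |η x| ≤ E * Real.exp (G * (q - p)) := by
  intro x hx
  have hE : 0 ≤ E := (abs_nonneg _).trans (bQ x hx)
  have hd : ∀ x ∈ Set.Icc p q, HasDerivAt (fun x => η x - Q x) (g x * Real.sin (η x)) x :=
    fun x hx => ((hη x hx).sub (hQ x hx)).congr_deriv (by ring)
  have key := norm_le_gronwallBound_of_norm_deriv_right_le (f := fun x => η x - Q x)
    (f' := fun x => g x * Real.sin (η x)) (δ := 0) (K := G) (ε := G * E) (a := p) (b := q)
    (fun x hx => (hd x hx).continuousAt.continuousWithinAt)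
    (fun x hx => (hd x (Set.Ico_subset_Icc_self hx)).hasDerivWithinAt) (by simp [h0, hQ0])
    (fun x hx => by
      have hx' := Set.Ico_subset_Icc_self hx
      rw [norm_mul, ← mul_add, Real.norm_eq_abs, Real.norm_eq_abs, Real.norm_eq_abs]
      refine mul_le_mul (bg x hx') ?_ (abs_nonneg _) hG.le
      have h1 : |Real.sin (η x)| ≤ |η x| := Real.abs_sin_le_abs
      have h2 : |η x| ≤ |η x - Q x| + |Q x| := by
        simpa using abs_add_le (η x - Q x) (Q x)
      linarith [bQ x hx']) x hx
  rw [gronwallBound_of_K_ne_0 hG.ne', Real.norm_eq_abs] at key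
  simp only [zero_mul, zero_add, mul_div_cancel_left₀ _ hG.ne'] at key
  have h2 : |η x| ≤ |η x - Q x| + |Q x| := by
    simpa using abs_add_le (η x - Q x) (Q x)
  have h3 : Real.exp (G * (x - p)) ≤ Real.exp (G * (q - p)) := by
    gcongr
    exact hx.2
  nlinarith [bQ x hx]

/-- The error bound for the oscillatory integrals on the block `[L, 4L]`. -/
noncomputable def oscillationError (B δ₀ Γ κ L : ℝ) : ℝ :=
  (2 + 3 * B + 6 * Γ / κ) / (δ₀ * L)

/-- The error in the decay of the amplitude across the block `[L, 4L]`. -/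
noncomputable def blockError (B δ₀ Γ κ c L : ℝ) : ℝ :=
  (2 * Γ * oscillationError B δ₀ Γ κ L +
    c * (3 * (2 * Γ * oscillationError B δ₀ Γ κ L / κ * Real.exp (3 * c / (2 * κ))))) / (4 * κ)

section Block

variable {ι : Type*} [DecidableEq ι] {V θ a a' : ℝ → ℝ} {S : Finset ι} {κ c φ : ι → ℝ} {m : ι}
  {L B δ₀ Γ : ℝ}

/-- On a block where the potential is `a · ∑ cₙ cos (2 κₙ x + φₙ)`, and where the phase `φₘ` has
been tuned to the Prüfer angle at the left end, the amplitude at energy `κₘ²` decreases by the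
factor `exp (-(cₘ / 4 κₘ) ∫ a)`, up to small errors. -/
theorem IsPruferAngle.logAmplitude_sub_le_of_resonant (hθ : IsPruferAngle V (κ m) θ)
    (hVc : Continuous V) (hm : m ∈ S) (hL : 0 < L) (hδ₀ : 0 < δ₀) (hκ : ∀ n, 0 < κ n)
    (hc : ∀ n, 0 < c n) (hΓ : ∑ n ∈ S, c n ≤ Γ)
    (ha : ∀ x, HasDerivAt a (a' x) x) (ca' : Continuous a')
    (h0a : ∀ x, 0 ≤ a x) (bA : ∀ x, a x ≤ 1 / L) (bA' : ∀ x, |a' x| ≤ B / L ^ 2)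
    (hV : ∀ x ∈ Set.Icc L (4 * L), V x = a x * ∑ n ∈ S, c n * Real.cos (2 * κ n * x + φ n))
    (hsep : ∀ n ∈ S, n ≠ m → δ₀ ≤ |2 * κ m - 2 * κ n|) (hlow : ∀ n ∈ S, δ₀ ≤ 2 * κ n)
    (hφ : φ m = 2 * θ L - 2 * κ m * L + Real.pi / 2) :
    ∀ x ∈ Set.Icc L (4 * L), logAmplitude V (κ m) θ x - logAmplitude V (κ m) θ L ≤
      -(c m / (4 * κ m)) * (∫ t in L..x, a t) + blockError B δ₀ Γ (κ m) (c m) L := by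
  have ca : Continuous a := continuous_iff_continuousAt.2 fun x => (ha x).continuousAt
  have cθ := hθ.continuous
  have hκm := hκ m
  set E := oscillationError B δ₀ Γ (κ m) L with hE
  have hΓ0 : 0 ≤ Γ := (Finset.sum_nonneg fun n _ => (hc n).le).trans hΓ
  have hB : 0 ≤ B := by
    have := (abs_nonneg _).trans (bA' 0)
    by_contra! h
    exact absurd this (not_le.2 (div_neg_of_neg_of_pos h (by positivity)))
  have bV : ∀ x ∈ Set.Icc L (4 * L), |V x| ≤ Γ / L := fun x hx => by
    rw [hV x hx, abs_mul, abs_of_nonneg (h0a x)]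
    have : |∑ n ∈ S, c n * Real.cos (2 * κ n * x + φ n)| ≤ Γ := by
      refine ((Finset.abs_sum_le_sum_abs _ _).trans (Finset.sum_le_sum fun n _ => ?_)).trans hΓ
      rw [abs_mul, abs_of_pos (hc n)]
      exact mul_le_of_le_one_right (hc n).le (Real.abs_cos_le_one _)
    calc a x * _ ≤ 1 / L * Γ := mul_le_mul (bA x) this (abs_nonneg _) (by positivity)
      _ = Γ / L := by ring
  -- the oscillatory integrals, with phase `2 s θ + 2 μ t + ν`
  let J : ℝ → ℝ → ℝ → ℝ → ℝ := fun s μ ν x =>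
    ∫ t in L..x, a t * Real.cos (s * (2 * θ t) + (2 * μ * t + ν))
  have dJ : ∀ s μ ν x, HasDerivAt (J s μ ν) (a x * Real.cos (s * (2 * θ x) + (2 * μ * x + ν))) x :=
    fun s μ ν x => intervalIntegral.integral_hasDerivAt_right
      (Continuous.intervalIntegrable (by fun_prop) _ _)
      (Continuous.stronglyMeasurableAtFilter (by fun_prop) _ _)
      (Continuous.continuousAt (by fun_prop))
  have J0 : ∀ s μ ν, J s μ ν L = 0 := fun s μ ν => intervalIntegral.integral_same
  have bJ : ∀ s μ ν, |s| ≤ 1 → δ₀ ≤ |2 * s * κ m + 2 * μ| → ∀ x ∈ Set.Icc L (4 * L),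
      |J s μ ν x| ≤ E := by
    intro s μ ν hs hδ x hx
    have hpos : 0 < |2 * s * κ m + 2 * μ| := hδ₀.trans_le hδ
    have sub : ∀ y ∈ Set.Icc L x, y ∈ Set.Icc L (4 * L) := fun y hy => ⟨hy.1, hy.2.trans hx.2⟩
    have := abs_integral_mul_cos_le (a := a) (a' := a')
      (ψ := fun t => s * (2 * θ t) + (2 * μ * t + ν))
      (ψ' := fun t => s * (2 * (κ m - V t / κ m * Real.sin (θ t) ^ 2)) + 2 * μ)
      (δ := 2 * s * κ m + 2 * μ) (A := 1 / L) (A' := B / L ^ 2) (ε := 2 * Γ / (L * κ m)) hx.1 ha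
      (fun t => by
        have h1 := ((hθ.hasDerivAt t).const_mul 2).const_mul s
        have h2 := ((hasDerivAt_id t).const_mul (2 * μ)).add_const ν
        exact (h1.add h2).congr_deriv (by simp)) ca' (by fun_prop)
      (abs_pos.1 hpos) (fun t _ => by rw [abs_of_nonneg (h0a t)]; exact bA t) (fun t _ => bA' t)
      (fun t ht => by
        have e : s * (2 * (κ m - V t / κ m * Real.sin (θ t) ^ 2)) + 2 * μ -
            (2 * s * κ m + 2 * μ) = -(2 * (s * (V t / κ m * Real.sin (θ t) ^ 2))) := by ring
        rw [e, abs_neg, abs_mul, abs_mul, abs_mul, abs_div, abs_of_pos hκm, abs_two, abs_pow]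
        have h1 : |Real.sin (θ t)| ^ 2 ≤ 1 := pow_le_one₀ (abs_nonneg _) (Real.abs_sin_le_one _)
        have h2 : |V t| / κ m ≤ Γ / L / κ m := by gcongr; exact bV t (sub t ht)
        calc 2 * (|s| * (|V t| / κ m * |Real.sin (θ t)| ^ 2))
            ≤ 2 * (1 * (Γ / L / κ m * 1)) := by gcongr
          _ = 2 * Γ / (L * κ m) := by field_simp)
    refine this.trans ?_
    have hx3 : x - L ≤ 3 * L := by linarith [hx.2]
    calc (2 * (1 / L) + (B / L ^ 2 + 1 / L * (2 * Γ / (L * κ m))) * (x - L)) /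
          |2 * s * κ m + 2 * μ|
        ≤ (2 * (1 / L) + (B / L ^ 2 + 1 / L * (2 * Γ / (L * κ m))) * (3 * L)) / δ₀ := by
          gcongr
      _ = E := by
          rw [hE, oscillationError]
          field_simp
          ring
  have hE0 : 0 ≤ E := (abs_nonneg _).trans
    (bJ 0 (κ m) 0 (by simp) (by simpa [abs_of_pos hκm] using hlow m hm) L ⟨le_rfl, by linarith⟩)
  have b0 : ∀ n ∈ S, ∀ ν, ∀ x ∈ Set.Icc L (4 * L), |J 0 (κ n) ν x| ≤ E := fun n hn ν =>
    bJ 0 (κ n) ν (by simp) (by simpa [abs_of_pos (hκ n)] using hlow n hn)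
  have b1 : ∀ n ∈ S, ∀ ν, ∀ x ∈ Set.Icc L (4 * L), |J 1 (κ n) ν x| ≤ E := fun n hn ν =>
    bJ 1 (κ n) ν (by simp) (by
      rw [abs_of_pos (by linarith [hκ n])]
      linarith [hlow n hn])
  have b2 : ∀ n ∈ S.erase m, ∀ ν, ∀ x ∈ Set.Icc L (4 * L), |J 1 (-κ n) ν x| ≤ E := fun n hn ν =>
    bJ 1 (-κ n) ν (by simp) (by
      have := hsep n (Finset.mem_of_mem_erase hn) (Finset.ne_of_mem_erase hn)
      convert this using 2
      ring)
  have bsum : ∀ T ⊆ S, ∀ F : ι → ℝ, (∀ n ∈ T, |F n| ≤ E) → |∑ n ∈ T, c n * F n| ≤ Γ * E := by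
    intro T hT F hF
    calc |∑ n ∈ T, c n * F n| ≤ ∑ n ∈ T, c n * E := by
          refine (Finset.abs_sum_le_sum_abs _ _).trans (Finset.sum_le_sum fun n hn => ?_)
          rw [abs_mul, abs_of_pos (hc n)]
          exact mul_le_mul_of_nonneg_left (hF n hn) (hc n).le
      _ ≤ ∑ n ∈ S, c n * E := Finset.sum_le_sum_of_subset_of_nonneg hT
          fun n _ _ => mul_nonneg (hc n).le hE0
      _ ≤ Γ * E := by rw [← Finset.sum_mul]; gcongr
  -- primitives of the non-resonant parts of `V sin 2θ` and of `V (1 - cos 2θ)`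
  let P : ℝ → ℝ := fun x => ∑ n ∈ S, c n * J 1 (κ n) (φ n - Real.pi / 2) x +
    ∑ n ∈ S.erase m, c n * J 1 (-κ n) (-φ n - Real.pi / 2) x
  let Q : ℝ → ℝ := fun x => ∑ n ∈ S, c n * J 0 (κ n) (φ n) x -
    (∑ n ∈ S, c n * J 1 (κ n) (φ n) x + ∑ n ∈ S.erase m, c n * J 1 (-κ n) (-φ n) x) / 2
  have bP : ∀ x ∈ Set.Icc L (4 * L), |P x| ≤ 2 * Γ * E := fun x hx => by
    have h1 := bsum S subset_rfl _ fun n hn => b1 n hn (φ n - Real.pi / 2) x hx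
    have h2 := bsum _ (S.erase_subset m) _ fun n hn => b2 n hn (-φ n - Real.pi / 2) x hx
    exact (abs_add_le _ _).trans (by linarith)
  have bQ : ∀ x ∈ Set.Icc L (4 * L), |Q x| ≤ 2 * Γ * E := fun x hx => by
    have h1 := abs_le.1 (bsum S subset_rfl _ fun n hn => b0 n hn (φ n) x hx)
    have h2 := abs_le.1 (bsum S subset_rfl _ fun n hn => b1 n hn (φ n) x hx)
    have h3 := abs_le.1 (bsum _ (S.erase_subset m) _ fun n hn => b2 n hn (-φ n) x hx)
    rw [abs_le]
    constructor <;> simp only [Q] <;> linarith [h1.1, h1.2, h2.1, h2.2, h3.1, h3.2]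
  have dP : ∀ x, HasDerivAt P _ x := fun x =>
    (HasDerivAt.fun_sum fun n (_ : n ∈ S) =>
      (dJ 1 (κ n) (φ n - Real.pi / 2) x).const_mul (c n)).add
    (HasDerivAt.fun_sum fun n (_ : n ∈ S.erase m) =>
      (dJ 1 (-κ n) (-φ n - Real.pi / 2) x).const_mul (c n))
  have dQ : ∀ x, HasDerivAt Q _ x := fun x =>
    (HasDerivAt.fun_sum fun n (_ : n ∈ S) => (dJ 0 (κ n) (φ n) x).const_mul (c n)).sub
    (((HasDerivAt.fun_sum fun n (_ : n ∈ S) => (dJ 1 (κ n) (φ n) x).const_mul (c n)).add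
    (HasDerivAt.fun_sum fun n (_ : n ∈ S.erase m) =>
      (dJ 1 (-κ n) (-φ n) x).const_mul (c n))).div_const 2)
  -- the resonant phase, shifted so that it vanishes at the left end
  let η : ℝ → ℝ := fun x => 2 * θ x - 2 * κ m * x - φ m + Real.pi / 2
  have cη : Continuous η := by fun_prop
  have η0 : η L = 0 := by simp only [η, hφ]; ring
  have dη : ∀ x ∈ Set.Icc L (4 * L), HasDerivAt η
      (c m * a x / (2 * κ m) * Real.sin (η x) + -(deriv Q x / κ m)) x := by
    intro x hx
    have h1 := ((((hθ.hasDerivAt x).const_mul 2).sub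
      ((hasDerivAt_id x).const_mul (2 * κ m))).sub_const (φ m)).add_const (Real.pi / 2)
    refine h1.congr_deriv ?_
    rw [(dQ x).deriv, hV x hx, ← Finset.add_sum_erase S _ hm, ← Finset.add_sum_erase S _ hm,
      ← Finset.add_sum_erase S _ hm, mul_one]
    have e : Real.sin (η x) = Real.cos (2 * θ x - (2 * κ m * x + φ m)) := by
      rw [← Real.sin_add_pi_div_two]
      congr 1
      simp only [η]
      ring
    have hcos : Real.sin (θ x) ^ 2 = (1 - Real.cos (2 * θ x)) / 2 := by
      rw [Real.cos_two_mul, Real.cos_sq']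
      ring
    have hterm : ∀ n, c n * (a x * Real.cos (0 * (2 * θ x) + (2 * κ n * x + φ n))) -
        (c n * (a x * Real.cos (1 * (2 * θ x) + (2 * κ n * x + φ n))) +
          c n * (a x * Real.cos (1 * (2 * θ x) + (2 * -κ n * x + -φ n)))) / 2 =
        a x * (c n * Real.cos (2 * κ n * x + φ n)) * (1 - Real.cos (2 * θ x)) := by
      intro n
      have : 2 * -κ n * x + -φ n = -(2 * κ n * x + φ n) := by ring
      rw [this, zero_mul, zero_add, one_mul, ← sub_eq_add_neg]
      generalize 2 * κ n * x + φ n = A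
      rw [Real.cos_add, Real.cos_sub]
      ring
    have hsum : ∑ n ∈ S.erase m, c n * (a x * Real.cos (0 * (2 * θ x) + (2 * κ n * x + φ n))) -
        (∑ n ∈ S.erase m, c n * (a x * Real.cos (1 * (2 * θ x) + (2 * κ n * x + φ n))) +
          ∑ n ∈ S.erase m, c n * (a x * Real.cos (1 * (2 * θ x) + (2 * -κ n * x + -φ n)))) / 2 =
        a x * (∑ n ∈ S.erase m, c n * Real.cos (2 * κ n * x + φ n)) *
          (1 - Real.cos (2 * θ x)) := by
      rw [← Finset.sum_add_distrib, Finset.sum_div, ← Finset.sum_sub_distrib, Finset.mul_sum,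
        Finset.sum_mul]
      exact Finset.sum_congr rfl fun n _ => hterm n
    have htm := hterm m
    have e2 : 2 * -κ m * x + -φ m = -(2 * κ m * x + φ m) := by ring
    rw [e2, one_mul, ← sub_eq_add_neg] at htm
    rw [e, hcos]
    simp only [one_mul] at hsum htm ⊢
    linear_combination (1 / κ m) * hsum + (1 / κ m) * htm
  have bη := abs_le_of_hasDerivAt_sin (η := η) (Q := fun x => -(Q x / κ m))
    (g := fun x => c m * a x / (2 * κ m)) (o := fun x => -(deriv Q x / κ m)) (p := L) (q := 4 * L)
    (G := c m / (2 * κ m * L)) (E := 2 * Γ * E / κ m) (by have := hc m; positivity) dη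
    (fun x _ => ((dQ x).differentiableAt.hasDerivAt.div_const (κ m)).neg) η0
    (by simp [Q, J0])
    (fun x _ => by
      have := hc m
      rw [abs_of_nonneg (by have := h0a x; positivity)]
      calc c m * a x / (2 * κ m) ≤ c m * (1 / L) / (2 * κ m) := by gcongr; exact bA x
        _ = c m / (2 * κ m * L) := by field_simp)
    (fun x hx => by
      rw [abs_neg, abs_div, abs_of_pos hκm]
      gcongr
      exact bQ x hx)
  have hexp : c m / (2 * κ m * L) * (4 * L - L) = 3 * c m / (2 * κ m) := by
    field_simp
    ring
  rw [hexp] at bη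
  -- the amplitude equals the resonant contribution plus `P`
  have dR : ∀ x, HasDerivAt (fun x => ∫ t in L..x, a t * Real.cos (η t)) (a x * Real.cos (η x)) x :=
    fun x => intervalIntegral.integral_hasDerivAt_right
      (Continuous.intervalIntegrable (by fun_prop) _ _)
      (Continuous.stronglyMeasurableAtFilter (by fun_prop) _ _)
      (Continuous.continuousAt (by fun_prop))
  have hconst := constant_of_has_deriv_right_zero (a := L) (b := 4 * L)
    (f := fun x => logAmplitude V (κ m) θ x -
      (P x - c m * ∫ t in L..x, a t * Real.cos (η t)) / (4 * κ m))
    (fun x _ => ((hθ.hasDerivAt_logAmplitude hVc x).sub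
      (((dP x).sub ((dR x).const_mul (c m))).div_const (4 * κ m))).continuousAt.continuousWithinAt)
    (fun x hx => by
      refine (((hθ.hasDerivAt_logAmplitude hVc x).sub
        (((dP x).sub ((dR x).const_mul (c m))).div_const (4 * κ m))).congr_deriv
          ?_).hasDerivWithinAt
      rw [hV x (Set.Ico_subset_Icc_self hx), ← Finset.add_sum_erase S _ hm,
        ← Finset.add_sum_erase S _ hm]
      have e : Real.cos (η x) = -Real.sin (2 * θ x - (2 * κ m * x + φ m)) := by
        rw [← Real.cos_add_pi_div_two]
        congr 1
        simp only [η]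
        ring
      have hterm : ∀ n, c n * (a x * Real.cos (1 * (2 * θ x) +
            (2 * κ n * x + (φ n - Real.pi / 2)))) +
          c n * (a x * Real.cos (1 * (2 * θ x) + (2 * -κ n * x + (-φ n - Real.pi / 2)))) =
          a x * (c n * Real.cos (2 * κ n * x + φ n)) * (2 * Real.sin (2 * θ x)) := by
        intro n
        have e1 : 1 * (2 * θ x) + (2 * κ n * x + (φ n - Real.pi / 2)) =
          (2 * θ x + (2 * κ n * x + φ n)) - Real.pi / 2 := by ring
        have e2 : 1 * (2 * θ x) + (2 * -κ n * x + (-φ n - Real.pi / 2)) =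
          (2 * θ x - (2 * κ n * x + φ n)) - Real.pi / 2 := by ring
        rw [e1, e2, Real.cos_sub_pi_div_two, Real.cos_sub_pi_div_two, Real.sin_add, Real.sin_sub]
        ring
      have hsum : ∑ n ∈ S.erase m, c n * (a x * Real.cos (1 * (2 * θ x) +
            (2 * κ n * x + (φ n - Real.pi / 2)))) +
          ∑ n ∈ S.erase m, c n * (a x * Real.cos (1 * (2 * θ x) +
            (2 * -κ n * x + (-φ n - Real.pi / 2)))) =
          a x * (∑ n ∈ S.erase m, c n * Real.cos (2 * κ n * x + φ n)) *
            (2 * Real.sin (2 * θ x)) := by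
        rw [← Finset.sum_add_distrib, Finset.mul_sum, Finset.sum_mul]
        exact Finset.sum_congr rfl fun n _ => hterm n
      have htm := hterm m
      have e2 : 1 * (2 * θ x) + (2 * -κ m * x + (-φ m - Real.pi / 2)) =
        (2 * θ x - (2 * κ m * x + φ m)) - Real.pi / 2 := by ring
      rw [e2, Real.cos_sub_pi_div_two] at htm
      rw [e]
      linear_combination (-1 / (4 * κ m)) * (hsum + htm))
  intro x hx
  have hx1 := hconst x hx
  have hP0 : P L = 0 := by simp [P, J0]
  simp only [hP0, intervalIntegral.integral_same, mul_zero, sub_zero, zero_div] at hx1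
  have hEη : 0 ≤ 2 * Γ * E / κ m * Real.exp (3 * c m / (2 * κ m)) := by positivity
  have hcosint : (∫ t in L..x, a t) - 3 * (2 * Γ * E / κ m * Real.exp (3 * c m / (2 * κ m))) ≤
      ∫ t in L..x, a t * Real.cos (η t) := by
    set D := 2 * Γ * E / κ m * Real.exp (3 * c m / (2 * κ m)) with hD
    have h1 : ∫ t in L..x, (a t - 1 / L * D) ≤ ∫ t in L..x, a t * Real.cos (η t) := by
      refine intervalIntegral.integral_mono_on hx.1
        (Continuous.intervalIntegrable (by fun_prop) _ _)
        (Continuous.intervalIntegrable (by fun_prop) _ _) fun t ht => ?_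
      have h2 := bη t ⟨ht.1, ht.2.trans hx.2⟩
      have h3 : 1 - Real.cos (η t) ≤ |η t| := by
        have h4 := Real.one_sub_sq_div_two_le_cos (x := η t)
        rcases le_total |η t| 2 with h5 | h5
        · nlinarith [sq_abs (η t), abs_nonneg (η t)]
        · linarith [Real.neg_one_le_cos (η t)]
      have h4 : 0 ≤ 1 - Real.cos (η t) := by linarith [Real.cos_le_one (η t)]
      have h5 : a t * (1 - Real.cos (η t)) ≤ 1 / L * D :=
        mul_le_mul (bA t) (h3.trans h2) h4 (by positivity)
      linarith
    rw [intervalIntegral.integral_sub (ca.intervalIntegrable _ _) (by simp)] at h1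
    have h2 : ∫ t in L..x, 1 / L * D ≤ 3 * D := by
      rw [intervalIntegral.integral_const, smul_eq_mul]
      have : x - L ≤ 3 * L := by linarith [hx.2]
      calc (x - L) * (1 / L * D) ≤ 3 * L * (1 / L * D) := by gcongr
        _ = 3 * D := by field_simp
    linarith
  have hfinal : logAmplitude V (κ m) θ x - logAmplitude V (κ m) θ L =
      (P x - c m * ∫ t in L..x, a t * Real.cos (η t)) / (4 * κ m) := by linarith
  have hblock : -(c m / (4 * κ m)) * (∫ t in L..x, a t) + blockError B δ₀ Γ (κ m) (c m) L =
      (2 * Γ * E - c m * ((∫ t in L..x, a t) -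
        3 * (2 * Γ * E / κ m * Real.exp (3 * c m / (2 * κ m))))) / (4 * κ m) := by
    rw [blockError, ← hE]
    field_simp
    ring
  rw [hfinal, hblock]
  have hPx := (abs_le.1 (bP x hx)).2
  have := mul_le_mul_of_nonneg_left hcosint (hc m).le
  gcongr

end Block

/-! ### Sums of functions living on geometrically separated blocks -/

section BlockSum

variable {E : Type*} [NormedAddCommGroup E] {f : ℕ → ℝ → E}

/-- The functions `f j` vanish on `[-4^j, 4^j]`, so the sum is locally finite. -/
theorem tsum_block_eq_sum (hf : ∀ j x, |x| ≤ 4 ^ j → f j x = 0) {N : ℕ} {x : ℝ}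
    (hx : |x| < 4 ^ N) : ∑' j, f j x = ∑ j ∈ Finset.range N, f j x := by
  refine tsum_eq_sum fun j hj => hf j x (hx.le.trans ?_)
  exact pow_le_pow_right₀ (by norm_num) (by simpa using hj)

theorem tsum_block_eventuallyEq (hf : ∀ j x, |x| ≤ 4 ^ j → f j x = 0) {N : ℕ} {x : ℝ}
    (hx : |x| < 4 ^ N) :
    (fun y => ∑' j, f j y) =ᶠ[𝓝 x] fun y => ∑ j ∈ Finset.range N, f j y := by
  filter_upwards [(isOpen_lt continuous_abs continuous_const).mem_nhds hx] with y hy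
  exact tsum_block_eq_sum hf hy

theorem exists_abs_lt_four_pow (x : ℝ) : ∃ N : ℕ, |x| < 4 ^ N :=
  pow_unbounded_of_one_lt _ (by norm_num)

variable [NormedSpace ℝ E]

theorem contDiff_tsum_block (hf : ∀ j x, |x| ≤ 4 ^ j → f j x = 0)
    (hs : ∀ j, ContDiff ℝ (⊤ : ℕ∞) (f j)) :
    ContDiff ℝ (⊤ : ℕ∞) fun x => ∑' j, f j x := by
  refine contDiff_iff_contDiffAt.2 fun x => ?_
  obtain ⟨N, hN⟩ := exists_abs_lt_four_pow x
  exact (ContDiff.sum fun j _ => hs j).contDiffAt.congr_of_eventuallyEq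
    (tsum_block_eventuallyEq hf hN)

theorem iteratedDeriv_tsum_block (hf : ∀ j x, |x| ≤ 4 ^ j → f j x = 0)
    (hs : ∀ j, ContDiff ℝ (⊤ : ℕ∞) (f j)) (k : ℕ) {N : ℕ} {x : ℝ} (hx : |x| < 4 ^ N) :
    iteratedDeriv k (fun x => ∑' j, f j x) x =
      ∑ j ∈ Finset.range N, iteratedDeriv k (f j) x := by
  rw [(tsum_block_eventuallyEq hf hx).iteratedDeriv_eq k, iteratedDeriv_fun_sum]
  exact fun j _ => ((hs j).of_le (by exact_mod_cast le_top)).contDiffAt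

end BlockSum

/-! ### The amplitude profile -/

/-- A fixed smooth bump function supported in `[1, 2]`. -/
noncomputable def blockBump : ContDiffBump (3 / 2 : ℝ) := ⟨1 / 4, 1 / 2, by norm_num, by norm_num⟩

/-- The amplitude of the potential on the block `[4^j, 4^(j+1)]`; it is of size `1 / x`. -/
noncomputable def blockAmplitude (j : ℕ) (x : ℝ) : ℝ := blockBump (x / 4 ^ j) / 4 ^ j

theorem blockBump_eq_zero_of_le {x : ℝ} (hx : x ≤ 1) : blockBump x = 0 := by
  refine blockBump.zero_of_le_dist ?_
  rw [Real.dist_eq, abs_sub_comm]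
  exact le_trans (by norm_num [blockBump]; linarith) (le_abs_self _)

theorem blockBump_eq_zero_of_ge {x : ℝ} (hx : 2 ≤ x) : blockBump x = 0 := by
  refine blockBump.zero_of_le_dist ?_
  rw [Real.dist_eq]
  exact le_trans (by norm_num [blockBump]; linarith) (le_abs_self _)

theorem blockAmplitude_eq_zero_of_le {j : ℕ} {x : ℝ} (hx : x ≤ 4 ^ j) :
    blockAmplitude j x = 0 := by
  rw [blockAmplitude, blockBump_eq_zero_of_le, zero_div]
  rwa [div_le_one (by positivity)]

theorem blockAmplitude_eq_zero_of_ge {j : ℕ} {x : ℝ} (hx : 2 * 4 ^ j ≤ x) :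
    blockAmplitude j x = 0 := by
  rw [blockAmplitude, blockBump_eq_zero_of_ge, zero_div]
  rwa [le_div_iff₀ (by positivity)]

theorem blockAmplitude_nonneg (j : ℕ) (x : ℝ) : 0 ≤ blockAmplitude j x :=
  div_nonneg blockBump.nonneg (by positivity)

theorem blockAmplitude_le (j : ℕ) (x : ℝ) : blockAmplitude j x ≤ 1 / 4 ^ j := by
  unfold blockAmplitude
  gcongr
  exact blockBump.le_one

theorem contDiff_blockAmplitude (j : ℕ) : ContDiff ℝ (⊤ : ℕ∞) (blockAmplitude j) :=
  (blockBump.contDiff.comp (contDiff_id.div_const _)).div_const _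

theorem exists_bound_iteratedDeriv_blockBump (k : ℕ) :
    ∃ B : ℝ, ∀ x, |iteratedDeriv k blockBump x| ≤ B := by
  have hc : Continuous (iteratedDeriv k blockBump) :=
    (blockBump.contDiff (n := (⊤ : ℕ∞))).continuous_iteratedDeriv k (by exact_mod_cast le_top)
  have hs : HasCompactSupport (iteratedDeriv k blockBump) := by
    have := blockBump.hasCompactSupport.iteratedFDeriv (𝕜 := ℝ) k
    refine this.mono fun x hx => ?_
    contrapose! hx
    simp [iteratedDeriv, Function.notMem_support.1 hx]
  exact hs.exists_bound_of_continuous hc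

theorem hasDerivAt_blockAmplitude (j : ℕ) (x : ℝ) :
    HasDerivAt (blockAmplitude j) (deriv blockBump (x / 4 ^ j) / (4 ^ j) ^ 2) x := by
  have h1 : HasDerivAt blockBump (deriv blockBump (x / 4 ^ j)) (x / 4 ^ j) :=
    ((blockBump.contDiff (n := 1)).differentiable (by norm_num) _).hasDerivAt
  have h2 := (h1.comp x ((hasDerivAt_id x).div_const (4 ^ j))).div_const (4 ^ j)
  exact h2.congr_deriv (by field_simp)

/-- The total mass of the bump function. -/
noncomputable def bumpMass : ℝ := ∫ x in (1 : ℝ)..4, blockBump x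

theorem bumpMass_pos : 0 < bumpMass := by
  refine intervalIntegral.integral_pos (by norm_num) blockBump.continuous.continuousOn
    (fun x _ => blockBump.nonneg) ⟨3 / 2, by norm_num, ?_⟩
  rw [blockBump.one_of_mem_closedBall (Metric.mem_closedBall_self blockBump.rIn_pos.le)]
  exact one_pos

theorem integral_blockAmplitude (j : ℕ) :
    ∫ x in (4 : ℝ) ^ j..4 * 4 ^ j, blockAmplitude j x = bumpMass := by
  unfold blockAmplitude bumpMass
  rw [intervalIntegral.integral_div, intervalIntegral.integral_comp_div _ (by positivity)]
  have h : (4 : ℝ) ^ j ≠ 0 := by positivity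
  rw [div_self h, mul_div_cancel_right₀ _ h, smul_eq_mul, mul_div_cancel_left₀ _ h]

/-! ### The potential -/

/-- The energies treated on the `j`-th block: a given energy is treated on all but finitely many
blocks, and `K` delays it until the block is long enough for it to be separated from the other
ones. -/
def activeSet (K : ℕ → ℕ) (j : ℕ) : Finset ℕ := (Finset.range j).filter fun n => K n ≤ j

/-- The coupling constant, chosen such that the amplitude at energy `κₙ²` decreases by the
factor `e⁻⁴` on every block, up to small errors. -/
noncomputable def coupling (κ : ℕ → ℝ) (n : ℕ) : ℝ := 16 * κ n / bumpMass

/-- The potential on the `j`-th block of the positive half-line. -/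
noncomputable def blockPotential (κ : ℕ → ℝ) (K : ℕ → ℕ) (φ : ℕ → ℕ → ℝ) (j : ℕ) (x : ℝ) : ℝ :=
  blockAmplitude j x * ∑ n ∈ activeSet K j, coupling κ n * Real.cos (2 * κ n * x + φ j n)

/-- The even potential with phases `φ`. -/
noncomputable def blockSumPotential (κ : ℕ → ℝ) (K : ℕ → ℕ) (φ : ℕ → ℕ → ℝ) (x : ℝ) : ℝ :=
  ∑' j, (blockPotential κ K φ j x + blockPotential κ K φ j (-x))

/-- The positive numbers `κₙ` are distinct, and `K` grows quickly enough to control the `κₙ`, their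
inverses and the inverses of their differences. -/
structure IsDelay (κ : ℕ → ℝ) (K : ℕ → ℕ) : Prop where
  pos : ∀ n, 0 < κ n
  injective : Function.Injective κ
  lt : ∀ n, n < K n
  le : ∀ n, κ n ≤ K n
  inv_le : ∀ n, 1 / κ n ≤ K n
  inv_sub_le : ∀ m n, m < n → 1 / |κ n - κ m| ≤ K n

section Potential

variable {κ : ℕ → ℝ} {K : ℕ → ℕ} {φ : ℕ → ℕ → ℝ}

theorem blockPotential_eq_zero_of_le {j : ℕ} {x : ℝ} (hx : x ≤ 4 ^ j) :
    blockPotential κ K φ j x = 0 := by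
  rw [blockPotential, blockAmplitude_eq_zero_of_le hx, zero_mul]

theorem blockPotential_eq_zero_of_ge {j : ℕ} {x : ℝ} (hx : 2 * 4 ^ j ≤ x) :
    blockPotential κ K φ j x = 0 := by
  rw [blockPotential, blockAmplitude_eq_zero_of_ge hx, zero_mul]

theorem blockPotential_add_neg_eq_zero (j : ℕ) (x : ℝ) (hx : |x| ≤ 4 ^ j) :
    blockPotential κ K φ j x + blockPotential κ K φ j (-x) = 0 := by
  rw [blockPotential_eq_zero_of_le ((le_abs_self x).trans hx),
    blockPotential_eq_zero_of_le ((neg_le_abs x).trans hx), add_zero]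

theorem contDiff_blockPotential (j : ℕ) :
    ContDiff ℝ (⊤ : ℕ∞) (blockPotential κ K φ j) := by
  refine (contDiff_blockAmplitude j).mul (ContDiff.sum fun n _ => ?_)
  exact contDiff_const.mul (Real.contDiff_cos.comp
    ((contDiff_const.mul contDiff_id).add contDiff_const))

theorem contDiff_blockSumPotential :
    ContDiff ℝ (⊤ : ℕ∞) (blockSumPotential κ K φ) :=
  contDiff_tsum_block blockPotential_add_neg_eq_zero fun j =>
    (contDiff_blockPotential j).add ((contDiff_blockPotential j).comp contDiff_neg)

theorem blockSumPotential_neg (x : ℝ) :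
    blockSumPotential κ K φ (-x) = blockSumPotential κ K φ x := by
  simp only [blockSumPotential, neg_neg, add_comm]

theorem blockSumPotential_eq_blockPotential {j : ℕ} {x : ℝ} (hx : x ∈ Set.Icc (4 ^ j) (4 * 4 ^ j)) :
    blockSumPotential κ K φ x = blockPotential κ K φ j x := by
  have hpos : ∀ i : ℕ, (0 : ℝ) < 4 ^ i := fun i => by positivity
  have hneg : ∀ i, blockPotential κ K φ i (-x) = 0 := fun i =>
    blockPotential_eq_zero_of_le (by linarith [hpos i, hpos j, hx.1])
  unfold blockSumPotential
  simp_rw [hneg, add_zero]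
  refine tsum_eq_single j fun i hi => ?_
  rcases lt_or_gt_of_ne hi with h | h
  · have : (4 : ℝ) ^ (i + 1) ≤ 4 ^ j := pow_le_pow_right₀ (by norm_num) h
    rw [pow_succ] at this
    exact blockPotential_eq_zero_of_ge (by linarith [hpos i, hx.1])
  · have : (4 : ℝ) ^ (j + 1) ≤ 4 ^ i := pow_le_pow_right₀ (by norm_num) h
    rw [pow_succ] at this
    exact blockPotential_eq_zero_of_le (by linarith [hx.2])

theorem blockSumPotential_eq_zero {x : ℝ} (hx : |x| ≤ 1) : blockSumPotential κ K φ x = 0 := by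
  unfold blockSumPotential
  simp [fun j => blockPotential_add_neg_eq_zero (κ := κ) (K := K) (φ := φ) j x
    (hx.trans (one_le_pow₀ (by norm_num)))]

theorem coupling_pos (h : IsDelay κ K) (n : ℕ) : 0 < coupling κ n := by
  have := bumpMass_pos
  have := h.pos n
  unfold coupling
  positivity

theorem sum_coupling_le (h : IsDelay κ K) (j : ℕ) :
    ∑ n ∈ activeSet K j, coupling κ n ≤ 16 / bumpMass * (j : ℝ) ^ 2 := by
  have hI := bumpMass_pos
  calc ∑ n ∈ activeSet K j, coupling κ n ≤ ∑ n ∈ activeSet K j, 16 * j / bumpMass := by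
        refine Finset.sum_le_sum fun n hn => ?_
        have hn' : (K n : ℝ) ≤ j := by exact_mod_cast (Finset.mem_filter.1 hn).2
        unfold coupling
        gcongr
        exact (h.le n).trans hn'
    _ = (activeSet K j).card * (16 * j / bumpMass) := by simp
    _ ≤ j * (16 * j / bumpMass) := by
        gcongr
        exact (Finset.card_filter_le _ _).trans (Finset.card_range j).le
    _ = _ := by ring

theorem abs_blockPotential_le (h : IsDelay κ K) (j : ℕ) (x : ℝ) :
    |blockPotential κ K φ j x| ≤ 16 / bumpMass := by
  have hI := bumpMass_pos
  have hsum : |∑ n ∈ activeSet K j, coupling κ n * Real.cos (2 * κ n * x + φ j n)| ≤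
      16 / bumpMass * (j : ℝ) ^ 2 := by
    refine ((Finset.abs_sum_le_sum_abs _ _).trans (Finset.sum_le_sum fun n _ => ?_)).trans
      (sum_coupling_le h j)
    rw [abs_mul, abs_of_pos (coupling_pos h n)]
    exact mul_le_of_le_one_right (coupling_pos h n).le (Real.abs_cos_le_one _)
  have hj : (j : ℝ) ^ 2 ≤ 4 ^ j := by
    have : j ^ 2 ≤ (2 ^ j) ^ 2 := Nat.pow_le_pow_left Nat.lt_two_pow_self.le 2
    rw [← pow_mul, mul_comm, pow_mul] at this
    exact_mod_cast this
  rw [blockPotential, abs_mul, abs_of_nonneg (blockAmplitude_nonneg j x)]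
  calc _ ≤ 1 / 4 ^ j * (16 / bumpMass * (j : ℝ) ^ 2) :=
        mul_le_mul (blockAmplitude_le j x) hsum (abs_nonneg _) (by positivity)
    _ ≤ 1 / 4 ^ j * (16 / bumpMass * 4 ^ j) := by gcongr
    _ = 16 / bumpMass := by field_simp

theorem abs_blockSumPotential_le (h : IsDelay κ K) (x : ℝ) :
    |blockSumPotential κ K φ x| ≤ 16 / bumpMass := by
  have key : ∀ x, 0 ≤ x → |blockSumPotential κ K φ x| ≤ 16 / bumpMass := fun x hx => by
    rcases le_total x 1 with h1 | h1
    · rw [blockSumPotential_eq_zero (by rwa [abs_of_nonneg hx]), abs_zero]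
      exact div_nonneg (by norm_num) bumpMass_pos.le
    · obtain ⟨j, hj, hj'⟩ := exists_nat_pow_near h1 (by norm_num : (1 : ℝ) < 4)
      rw [blockSumPotential_eq_blockPotential (j := j) ⟨hj, by rw [← pow_succ']; exact hj'.le⟩]
      exact abs_blockPotential_le h j x
  rcases le_total 0 x with hx | hx
  · exact key x hx
  · rw [← blockSumPotential_neg]
    exact key _ (neg_nonneg.2 hx)

/-- Below `4^j` only the phases of the earlier blocks matter. -/
theorem blockSumPotential_congr {ψ : ℕ → ℕ → ℝ} {j : ℕ} (h : ∀ i < j, φ i = ψ i) {x : ℝ}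
    (hx : x ∈ Set.Ico 0 (4 ^ j)) :
    blockSumPotential κ K φ x = blockSumPotential κ K ψ x := by
  have hx' : |x| < 4 ^ j := by rw [abs_of_nonneg hx.1]; exact hx.2
  unfold blockSumPotential
  rw [tsum_block_eq_sum blockPotential_add_neg_eq_zero hx',
    tsum_block_eq_sum blockPotential_add_neg_eq_zero hx']
  refine Finset.sum_congr rfl fun i hi => ?_
  simp only [blockPotential, h i (Finset.mem_range.1 hi)]

end Potential

/-! ### Choice of the phases -/

/-- A causal recursion, in which the `j`-th term is prescribed by the earlier ones, is solvable. -/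
theorem exists_eq_of_causal {X : Type*} [Inhabited X] (G : ℕ → (ℕ → X) → X)
    (hG : ∀ j f g, (∀ i < j, f i = g i) → G j f = G j g) : ∃ f : ℕ → X, ∀ j, f j = G j f := by
  let f : ℕ → X := fun j => Nat.strongRec
    (fun j ih => G j fun i => if h : i < j then ih i h else default) j
  refine ⟨f, fun j => ?_⟩
  have : f j = G j fun i => if i < j then f i else default := by
    simp only [f]
    rw [Nat.strongRec]
    rfl
  rw [this]
  exact hG j _ _ fun i hi => by simp [hi]

/-- The phases can be chosen so that on every block each of them is tuned to the Prüfer angle with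
which the solution enters the block. -/
theorem exists_tuned_phases {κ : ℕ → ℝ} {K : ℕ → ℕ} (h : IsDelay κ K) :
    ∃ (φ : ℕ → ℕ → ℝ) (θ : ℕ → ℝ → ℝ),
      (∀ n, IsPruferAngle (blockSumPotential κ K φ) (κ n) (θ n)) ∧
      ∀ j n, φ j n = 2 * θ n (4 ^ j) - 2 * κ n * 4 ^ j + Real.pi / 2 := by
  have hex : ∀ (φ : ℕ → ℕ → ℝ) (n : ℕ), ∃ θ, IsPruferAngle (blockSumPotential κ K φ) (κ n) θ :=
    fun φ n => exists_isPruferAngle contDiff_blockSumPotential.continuous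
      (abs_blockSumPotential_le h) (κ n)
  choose Θ hΘ using hex
  obtain ⟨φ, hφ⟩ := exists_eq_of_causal
    (fun j φ n => 2 * Θ φ n (4 ^ j) - 2 * κ n * 4 ^ j + Real.pi / 2) fun j φ ψ hφψ => by
      funext n
      have := (hΘ φ n).eqOn_Icc (hΘ ψ n) (abs_blockSumPotential_le h)
        (fun x hx => blockSumPotential_congr hφψ hx) ⟨by positivity, le_refl ((4 : ℝ) ^ j)⟩
      rw [this]
  exact ⟨φ, Θ φ, hΘ φ, fun j n => congrFun (hφ j) n⟩

/-- When separation `1 / j` and total coupling of order `j²` are admitted on the block of length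
`4 ^ j`, the error of the resonance estimate tends to zero. -/
theorem tendsto_blockError {κ c I B : ℝ} :
    Tendsto (fun j : ℕ => blockError B (1 / j) (I * (j : ℝ) ^ 2) κ c (4 ^ j)) atTop (𝓝 0) := by
  have h3 := tendsto_pow_const_div_const_pow_of_one_lt 3 (by norm_num : (1 : ℝ) < 4)
  have h5 := tendsto_pow_const_div_const_pow_of_one_lt 5 (by norm_num : (1 : ℝ) < 4)
  set D := (2 * I + c * (3 * (2 * I / κ * Real.exp (3 * c / (2 * κ))))) / (4 * κ) with hD
  have h := (h3.const_mul (D * (2 + 3 * B))).add (h5.const_mul (D * (6 * I / κ)))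
  simp only [mul_zero, add_zero] at h
  refine h.congr fun j => ?_
  rw [hD, blockError, oscillationError, one_div_mul_eq_div, div_div_eq_mul_div]
  ring

/-- With tuned phases, the solution of energy `κₘ²` vanishing at the origin decays, for every
`m`. -/
theorem exists_exp_logAmplitude_le {κ : ℕ → ℝ} {K : ℕ → ℕ} (h : IsDelay κ K)
    {φ : ℕ → ℕ → ℝ} {θ : ℕ → ℝ → ℝ}
    (hθ : ∀ n, IsPruferAngle (blockSumPotential κ K φ) (κ n) (θ n))
    (hφ : ∀ j n, φ j n = 2 * θ n (4 ^ j) - 2 * κ n * 4 ^ j + Real.pi / 2) (m : ℕ) :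
    ∃ C, ∀ x, Real.exp (logAmplitude (blockSumPotential κ K φ) (κ m) (θ m) x) ≤
      C / (1 + x ^ 2) := by
  set V := blockSumPotential κ K φ with hVdef
  have hVc : Continuous V := contDiff_blockSumPotential.continuous
  set ρ := logAmplitude V (κ m) (θ m) with hρ
  have hI := bumpMass_pos
  have hκm := h.pos m
  have cρ : Continuous ρ := continuous_iff_continuousAt.2 fun x =>
    ((hθ m).hasDerivAt_logAmplitude hVc x).continuousAt
  obtain ⟨B, hB⟩ := exists_bound_iteratedDeriv_blockBump 1
  obtain ⟨J₀, hJ₀⟩ := eventually_atTop.1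
    ((tendsto_blockError (κ := κ m) (c := coupling κ m) (I := 16 / bumpMass) (B := B)).eventually
      (gt_mem_nhds one_pos))
  set J := max J₀ (K m)
  have hblock : ∀ j, J ≤ j → ∀ x ∈ Set.Icc ((4 : ℝ) ^ j) (4 * 4 ^ j), ρ x - ρ (4 ^ j) ≤
      -(coupling κ m / (4 * κ m)) * (∫ t in (4 : ℝ) ^ j..x, blockAmplitude j t) + 1 := by
    intro j hj x hx
    have hKj : K m ≤ j := (le_max_right _ _).trans hj
    have hmj : m ∈ activeSet K j :=
      Finset.mem_filter.2 ⟨Finset.mem_range.2 ((h.lt m).trans_le hKj), hKj⟩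
    have hj0 : (0 : ℝ) < j := by exact_mod_cast (Nat.zero_le m).trans_lt ((h.lt m).trans_le hKj)
    have hact : ∀ n ∈ activeSet K j, (K n : ℝ) ≤ j := fun n hn => by
      exact_mod_cast (Finset.mem_filter.1 hn).2
    have hsep : ∀ a b, a < b → (K b : ℝ) ≤ j → 1 / (j : ℝ) ≤ |2 * κ b - 2 * κ a| := by
      intro a b hab hbj
      have hne : 0 < |κ b - κ a| := abs_pos.2 (sub_ne_zero.2 (h.injective.ne hab.ne'))
      have := (h.inv_sub_le a b hab).trans hbj
      rw [div_le_iff₀ hne] at this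
      rw [← mul_sub, abs_mul, abs_two, div_le_iff₀ hj0]
      nlinarith
    have key := (hθ m).logAmplitude_sub_le_of_resonant (a := blockAmplitude j)
      (a' := fun x => deriv blockBump (x / 4 ^ j) / (4 ^ j) ^ 2) (S := activeSet K j)
      (c := coupling κ) (φ := φ j) (L := 4 ^ j) (B := B) (δ₀ := 1 / j)
      (Γ := 16 / bumpMass * (j : ℝ) ^ 2) hVc hmj (by positivity) (by positivity) h.pos
      (coupling_pos h) (sum_coupling_le h j) (hasDerivAt_blockAmplitude j)
      (by
        have : Continuous (deriv blockBump) :=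
          (blockBump.contDiff (n := 1)).continuous_deriv (by norm_num)
        fun_prop)
      (blockAmplitude_nonneg j) (blockAmplitude_le j)
      (fun x => by
        rw [abs_div, abs_of_pos (by positivity : (0 : ℝ) < (4 ^ j) ^ 2)]
        gcongr
        simpa using hB (x / 4 ^ j))
      (fun x hx => by rw [hVdef, blockSumPotential_eq_blockPotential hx, blockPotential])
      (fun n hn hnm => by
        rcases lt_or_gt_of_ne hnm with h1 | h1
        · exact hsep n m h1 (by exact_mod_cast hKj)
        · rw [abs_sub_comm]
          exact hsep m n h1 (hact n hn))
      (fun n hn => by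
        have := (h.inv_le n).trans (hact n hn)
        rw [div_le_iff₀ (h.pos n)] at this
        rw [div_le_iff₀ hj0]
        linarith)
      (hφ j m) x hx
    have herr := hJ₀ j ((le_max_left _ _).trans hj)
    exact key.trans (by linarith)
  -- every block gains at least `e⁻³`, which beats the factor `16` lost by the weight `1 + x²`
  have hstep : ∀ j, J ≤ j → ρ (4 ^ (j + 1)) ≤ ρ (4 ^ j) - 3 := fun j hj => by
    have := hblock j hj (4 * 4 ^ j) ⟨by linarith [pow_pos (by norm_num : (0 : ℝ) < 4) j], le_rfl⟩
    rw [integral_blockAmplitude] at this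
    have e : coupling κ m / (4 * κ m) * bumpMass = 4 := by
      unfold coupling
      field_simp
      norm_num
    rw [pow_succ']
    linarith
  have hiter : ∀ i : ℕ, ρ (4 ^ (J + i)) ≤ ρ (4 ^ J) - 3 * i := fun i => by
    induction i with
    | zero => simp
    | succ i ih =>
      have := hstep (J + i) (by omega)
      rw [← add_assoc]
      push_cast
      linarith
  have hinside : ∀ j, J ≤ j → ∀ x ∈ Set.Icc ((4 : ℝ) ^ j) (4 * 4 ^ j), ρ x ≤ ρ (4 ^ j) + 1 := by
    intro j hj x hx
    have h1 := hblock j hj x hx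
    have h2 : 0 ≤ ∫ t in (4 : ℝ) ^ j..x, blockAmplitude j t :=
      intervalIntegral.integral_nonneg hx.1 fun t _ => blockAmplitude_nonneg j t
    have h3 : 0 ≤ coupling κ m / (4 * κ m) := by have := coupling_pos h m; positivity
    nlinarith
  obtain ⟨C₁, hC₁⟩ := (isCompact_Icc (a := (0 : ℝ)) (b := 4 ^ J)).exists_bound_of_continuousOn
    (f := fun x => (1 + x ^ 2) * Real.exp (ρ x)) (by fun_prop)
  have hpos : ∀ x, 0 ≤ x →
      Real.exp (ρ x) ≤ max C₁ (17 * Real.exp (ρ (4 ^ J) + 3 * J + 1)) / (1 + x ^ 2) := by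
    intro x hx
    rw [le_div_iff₀ (by positivity), mul_comm]
    rcases le_total x (4 ^ J) with hxJ | hxJ
    · exact ((le_abs_self _).trans (hC₁ x ⟨hx, hxJ⟩)).trans (le_max_left _ _)
    · refine le_trans ?_ (le_max_right _ _)
      obtain ⟨j, hj, hj'⟩ := exists_nat_pow_near
        ((one_le_pow₀ (by norm_num : (1 : ℝ) ≤ 4)).trans hxJ) (by norm_num : (1 : ℝ) < 4)
      have hJj : J ≤ j := by
        have := hxJ.trans_lt hj'
        have := (pow_lt_pow_iff_right₀ (by norm_num : (1 : ℝ) < 4)).1 this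
        omega
      obtain ⟨i, rfl⟩ := Nat.exists_eq_add_of_le hJj
      have h1 := hinside _ hJj x ⟨hj, by rw [← pow_succ']; exact hj'.le⟩
      have h2 := hiter i
      have h3 : 1 + x ^ 2 ≤ 17 * Real.exp (3 * ((J + i : ℕ) : ℝ)) := by
        have e3 : (16 : ℝ) ≤ Real.exp 3 := by
          have : Real.exp 3 = Real.exp 1 ^ 3 := by rw [← Real.exp_nat_mul]; norm_num
          rw [this]
          calc (16 : ℝ) ≤ 2.7 ^ 3 := by norm_num
            _ ≤ Real.exp 1 ^ 3 := by gcongr; linarith [Real.exp_one_gt_d9]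
        have e4 : (16 : ℝ) ^ (J + i) ≤ Real.exp (3 * ((J + i : ℕ) : ℝ)) := by
          rw [mul_comm, Real.exp_nat_mul]
          gcongr
        have e5 : x ^ 2 ≤ 16 * 16 ^ (J + i) := by
          calc x ^ 2 ≤ (4 ^ (J + i + 1)) ^ 2 := by gcongr
            _ = 16 * 16 ^ (J + i) := by
              rw [← pow_mul, mul_comm, pow_mul, pow_succ]
              norm_num
              ring
        have e6 : (1 : ℝ) ≤ 16 ^ (J + i) := one_le_pow₀ (by norm_num)
        linarith
      calc (1 + x ^ 2) * Real.exp (ρ x)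
          ≤ 17 * Real.exp (3 * ((J + i : ℕ) : ℝ)) * Real.exp (ρ (4 ^ J) - 3 * i + 1) := by
            gcongr
            linarith
        _ = 17 * Real.exp (ρ (4 ^ J) + 3 * J + 1) := by
            rw [mul_assoc, ← Real.exp_add]
            congr 2
            push_cast
            ring
  refine ⟨max C₁ (17 * Real.exp (ρ (4 ^ J) + 3 * J + 1)), fun x => ?_⟩
  rcases le_total 0 x with hx | hx
  · exact hpos x hx
  · have := hpos (-x) (neg_nonneg.2 hx)
    rwa [hρ, (hθ m).logAmplitude_neg blockSumPotential_neg (abs_blockSumPotential_le h),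
      neg_sq] at this

/-! ### The potential as an almost periodic coefficient -/

theorem japaneseBracket_pos {E : Type*} [NormedAddCommGroup E] (x : E) : 0 < japaneseBracket x :=
  Real.sqrt_pos.2 (by positivity)

theorem japaneseBracket_le {E : Type*} [NormedAddCommGroup E] (x : E) :
    japaneseBracket x ≤ 1 + ‖x‖ :=
  Real.sqrt_le_iff.2 ⟨by positivity, by nlinarith [norm_nonneg x]⟩

theorem isAlmostPeriodicCoefficient_zero {d : ℕ} (ω : EuclideanSpace ℝ (Fin d)) :
    IsAlmostPeriodicCoefficient ω 0 := by
  refine ⟨contDiff_const, 0, ⟨fun _ => contDiff_const, fun x => ?_, fun k N => ⟨1, one_pos,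
    fun θ x => ?_⟩⟩, fun k N => ⟨1, one_pos, fun n x => ?_⟩⟩
  · simp
  all_goals
    have h : iteratedDeriv k (0 : ℝ → ℂ) x = 0 := by
      simp [iteratedDeriv_const (c := (0 : ℂ)), show (0 : ℝ → ℂ) = fun _ => 0 from rfl]
    have h1 := japaneseBracket_pos x
    rw [Pi.zero_apply, h, norm_zero]
  · have h2 := japaneseBracket_pos (θ : ℝ)
    positivity
  · have h2 := japaneseBracket_pos (latticePoint n)
    positivity

/-- The amplitudes on the blocks satisfy symbol estimates which are uniform in the block. -/
theorem exists_iteratedDeriv_blockAmplitude_le (k : ℕ) : ∃ B : ℝ, 0 ≤ B ∧ ∀ (j : ℕ) (x : ℝ),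
    |iteratedDeriv k (blockAmplitude j) x| ≤ B / japaneseBracket x ^ k / 4 ^ j := by
  have hc : Continuous (iteratedDeriv k blockBump) :=
    (blockBump.contDiff (n := (⊤ : ℕ∞))).continuous_iteratedDeriv k (by exact_mod_cast le_top)
  have hs : HasCompactSupport fun y => iteratedDeriv k blockBump y * (1 + |y|) ^ k := by
    have : HasCompactSupport (iteratedDeriv k blockBump) := by
      refine (blockBump.hasCompactSupport.iteratedFDeriv (𝕜 := ℝ) k).mono fun x hx => ?_
      contrapose! hx
      simp [iteratedDeriv, Function.notMem_support.1 hx]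
    exact this.mul_right
  obtain ⟨B, hB⟩ := hs.exists_bound_of_continuous (by fun_prop)
  refine ⟨B, (norm_nonneg _).trans (hB 0), fun j x => ?_⟩
  have h4 : (0 : ℝ) < 4 ^ j := by positivity
  have h1 : (1 : ℝ) ≤ 4 ^ j := one_le_pow₀ (by norm_num)
  have e : iteratedDeriv k (blockAmplitude j) x =
      (1 / 4 ^ j) ^ k * iteratedDeriv k blockBump (x / 4 ^ j) / 4 ^ j := by
    have h2 := congrFun (iteratedDeriv_comp_const_mul (n := k) (f := blockBump)
      (blockBump.contDiff (n := k)) (1 / 4 ^ j)) x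
    have h3 : blockAmplitude j = fun x => blockBump (1 / 4 ^ j * x) / 4 ^ j := by
      ext x
      rw [blockAmplitude, one_div_mul_eq_div]
    rw [h3, iteratedDeriv_div_const, h2, one_div_mul_eq_div]
  have hx := hB (x / 4 ^ j)
  rw [Real.norm_eq_abs, abs_mul, abs_of_pos (by positivity : (0 : ℝ) < (1 + |x / 4 ^ j|) ^ k),
    abs_div, abs_of_pos h4] at hx
  rw [e, abs_div, abs_mul, abs_of_pos h4, abs_of_pos (by positivity : (0 : ℝ) < (1 / 4 ^ j) ^ k)]
  gcongr
  rw [le_div_iff₀ (pow_pos (japaneseBracket_pos x) k)]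
  calc (1 / 4 ^ j) ^ k * |iteratedDeriv k blockBump (x / 4 ^ j)| * japaneseBracket x ^ k
      ≤ (1 / 4 ^ j) ^ k * |iteratedDeriv k blockBump (x / 4 ^ j)| * (4 ^ j + |x|) ^ k := by
        gcongr
        · exact (japaneseBracket_pos x).le
        · exact (japaneseBracket_le x).trans (by rw [Real.norm_eq_abs]; gcongr)
    _ = |iteratedDeriv k blockBump (x / 4 ^ j)| * (1 + |x| / 4 ^ j) ^ k := by
        rw [mul_comm ((1 / 4 ^ j : ℝ) ^ k), mul_assoc, ← mul_pow]
        congr 2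
        field_simp
    _ ≤ B := hx

/-- The contribution of the `j`-th block to the coefficient `w_θ` with `θ = 2 σ κₙ`, `σ = ± 1`. -/
noncomputable def componentBlock (κ : ℕ → ℝ) (K : ℕ → ℕ) (φ : ℕ → ℕ → ℝ) (σ : ℝ) (n j : ℕ)
    (x : ℝ) : ℂ :=
  if n ∈ activeSet K j then
    blockAmplitude j x • (coupling κ n / 2 * Complex.exp (Complex.I * (σ * φ j n : ℝ))) +
      blockAmplitude j (-x) • (coupling κ n / 2 * Complex.exp (-(Complex.I * (σ * φ j n : ℝ))))
  else 0

/-- The coefficient `w_θ` with `θ = 2 σ κₙ`, `σ = ± 1`. -/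
noncomputable def component (κ : ℕ → ℝ) (K : ℕ → ℕ) (φ : ℕ → ℕ → ℝ) (σ : ℝ) (n : ℕ) (x : ℝ) : ℂ :=
  ∑' j, componentBlock κ K φ σ n j x

section Component

variable {κ : ℕ → ℝ} {K : ℕ → ℕ} {φ : ℕ → ℕ → ℝ} {σ : ℝ} {n : ℕ}

theorem componentBlock_eq_zero (j : ℕ) (x : ℝ) (hx : |x| ≤ 4 ^ j) :
    componentBlock κ K φ σ n j x = 0 := by
  unfold componentBlock
  rw [blockAmplitude_eq_zero_of_le ((le_abs_self x).trans hx),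
    blockAmplitude_eq_zero_of_le ((neg_le_abs x).trans hx)]
  simp

theorem contDiff_componentBlock (j : ℕ) :
    ContDiff ℝ (⊤ : ℕ∞) (componentBlock κ K φ σ n j) := by
  unfold componentBlock
  split_ifs
  · exact ((contDiff_blockAmplitude j).smul contDiff_const).add
      (((contDiff_blockAmplitude j).comp contDiff_neg).smul contDiff_const)
  · exact contDiff_const

theorem contDiff_component : ContDiff ℝ (⊤ : ℕ∞) (component κ K φ σ n) :=
  contDiff_tsum_block componentBlock_eq_zero contDiff_componentBlock

theorem norm_iteratedDeriv_componentBlock_le (h : IsDelay κ K) {k : ℕ} {B : ℝ} (hB0 : 0 ≤ B)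
    (hB : ∀ (j : ℕ) (x : ℝ),
      |iteratedDeriv k (blockAmplitude j) x| ≤ B / japaneseBracket x ^ k / 4 ^ j) (j : ℕ) (x : ℝ) :
    ‖iteratedDeriv k (componentBlock κ K φ σ n j) x‖ ≤
      coupling κ n * (B / japaneseBracket x ^ k) * (1 / 2) ^ K n * (1 / 2) ^ j := by
  have hc := coupling_pos h n
  have hjb := japaneseBracket_pos x
  by_cases hn : n ∈ activeSet K j
  · have e : componentBlock κ K φ σ n j = fun x =>
        blockAmplitude j x • (coupling κ n / 2 * Complex.exp (Complex.I * (σ * φ j n : ℝ))) +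
        blockAmplitude j (-x) •
          (coupling κ n / 2 * Complex.exp (-(Complex.I * (σ * φ j n : ℝ)))) := by
      ext x
      rw [componentBlock, if_pos hn]
    have hd : ∀ x, ContDiffAt ℝ k (blockAmplitude j) x := fun x =>
      ((contDiff_blockAmplitude j).of_le (by exact_mod_cast le_top)).contDiffAt
    have hd' : ContDiffAt ℝ k (fun x => blockAmplitude j (-x)) x :=
      (hd (-x)).comp x contDiff_neg.contDiffAt
    have hb := hB j x
    have hb' := hB j (-x)
    have hjn : japaneseBracket (-x) = japaneseBracket x := by simp [japaneseBracket]
    rw [hjn] at hb'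
    have hz : ‖(coupling κ n / 2 * Complex.exp (Complex.I * (σ * φ j n : ℝ)) : ℂ)‖ =
        coupling κ n / 2 := by
      rw [norm_mul, Complex.norm_exp_I_mul_ofReal, mul_one, norm_div, Complex.norm_real,
        Real.norm_eq_abs, abs_of_pos hc]
      simp
    have hz' : ‖(coupling κ n / 2 * Complex.exp (-(Complex.I * (σ * φ j n : ℝ))) : ℂ)‖ =
        coupling κ n / 2 := by
      rw [← mul_neg, ← Complex.ofReal_neg, norm_mul, Complex.norm_exp_I_mul_ofReal, mul_one,
        norm_div, Complex.norm_real, Real.norm_eq_abs, abs_of_pos hc]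
      simp
    have hs : ∀ z : ℂ, ContDiffAt ℝ k (fun x => blockAmplitude j x • z) x := fun z =>
      (hd x).smul contDiffAt_const
    have hs' : ∀ z : ℂ, ContDiffAt ℝ k (fun x => blockAmplitude j (-x) • z) x := fun z =>
      hd'.smul contDiffAt_const
    rw [e, iteratedDeriv_fun_add (hs _) (hs' _), iteratedDeriv_smul_const (hd x),
      iteratedDeriv_smul_const hd',
      iteratedDeriv_comp_neg k (blockAmplitude j)]
    have hKj : (1 / 2 : ℝ) ^ j ≤ (1 / 2) ^ K n :=
      pow_le_pow_of_le_one (by norm_num) (by norm_num) (Finset.mem_filter.1 hn).2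
    calc _ ≤ B / japaneseBracket x ^ k / 4 ^ j * (coupling κ n / 2) +
          B / japaneseBracket x ^ k / 4 ^ j * (coupling κ n / 2) := by
          refine (norm_add_le _ _).trans (add_le_add ?_ ?_)
          · rw [norm_smul, hz, Real.norm_eq_abs]
            gcongr
          · rw [norm_smul, hz', norm_smul, norm_pow, norm_neg, norm_one, one_pow, one_mul,
              Real.norm_eq_abs]
            gcongr
      _ = coupling κ n * (B / japaneseBracket x ^ k) * ((1 / 2) ^ j * (1 / 2) ^ j) := by
          rw [← mul_pow, div_eq_mul_inv _ ((4 : ℝ) ^ j), ← inv_pow]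
          norm_num
          ring
      _ ≤ coupling κ n * (B / japaneseBracket x ^ k) * ((1 / 2) ^ K n * (1 / 2) ^ j) := by
          gcongr
      _ = _ := by ring
  · have e : componentBlock κ K φ σ n j = fun _ => 0 := by
      ext x
      rw [componentBlock, if_neg hn]
    rw [e]
    simp only [iteratedDeriv_const, ite_self, norm_zero]
    positivity

/-- On the support of the component `4 ^ j ≥ 4 ^ K n`; one half of the decay `4⁻ʲ` of the amplitude
sums the blocks, and the other half makes the component small in `K n`. -/
theorem exists_norm_iteratedDeriv_component_le (h : IsDelay κ K) (k : ℕ) :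
    ∃ B : ℝ, 0 ≤ B ∧ ∀ σ n x, ‖iteratedDeriv k (component κ K φ σ n) x‖ ≤
      B * (K n * (1 / 2) ^ K n) / japaneseBracket x ^ k := by
  obtain ⟨B, hB0, hB⟩ := exists_iteratedDeriv_blockAmplitude_le k
  have hI := bumpMass_pos
  refine ⟨32 * B / bumpMass, by positivity, fun σ n x => ?_⟩
  have hjb := japaneseBracket_pos x
  obtain ⟨N, hN⟩ := exists_abs_lt_four_pow x
  have hc := coupling_pos h n
  have hgeom : ∑ j ∈ Finset.range N, (1 / 2 : ℝ) ^ j ≤ 2 := by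
    have := sum_geometric_two_le N
    simpa using this
  have hcK : coupling κ n ≤ 16 * K n / bumpMass := by
    unfold coupling
    gcongr
    exact h.le n
  unfold component
  rw [iteratedDeriv_tsum_block componentBlock_eq_zero contDiff_componentBlock k hN]
  calc _ ≤ ∑ j ∈ Finset.range N,
        coupling κ n * (B / japaneseBracket x ^ k) * (1 / 2) ^ K n * (1 / 2) ^ j :=
        (norm_sum_le _ _).trans (Finset.sum_le_sum fun j _ =>
          norm_iteratedDeriv_componentBlock_le h hB0 hB j x)
    _ = coupling κ n * (B / japaneseBracket x ^ k) * (1 / 2) ^ K n *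
        ∑ j ∈ Finset.range N, (1 / 2) ^ j := by rw [Finset.mul_sum]
    _ ≤ 16 * K n / bumpMass * (B / japaneseBracket x ^ k) * (1 / 2) ^ K n * 2 := by gcongr
    _ = _ := by ring

theorem component_eq_sum {N : ℕ} {x : ℝ} (hx : |x| < 4 ^ N) :
    component κ K φ σ n x = ∑ j ∈ Finset.range N, componentBlock κ K φ σ n j x :=
  tsum_block_eq_sum componentBlock_eq_zero hx

theorem component_eq_zero {N : ℕ} {x : ℝ} (hx : |x| < 4 ^ N) (hn : N ≤ n) :
    component κ K φ σ n x = 0 := by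
  rw [component_eq_sum hx]
  refine Finset.sum_eq_zero fun j hj => ?_
  have : n ∉ activeSet K j := fun hn' => by
    have h1 := Finset.mem_range.1 (Finset.mem_filter.1 hn').1
    have h2 := Finset.mem_range.1 hj
    omega
  rw [componentBlock, if_neg this]

/-- Euler's formula on one block. -/
theorem exp_mul_componentBlock_add (n j : ℕ) (x : ℝ) :
    Complex.exp (Complex.I * ((2 * κ n : ℝ) : ℂ) * x) * componentBlock κ K φ 1 n j x +
      Complex.exp (Complex.I * ((-(2 * κ n) : ℝ) : ℂ) * x) * componentBlock κ K φ (-1) n j x =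
    if n ∈ activeSet K j then
      ((blockAmplitude j x * (coupling κ n * Real.cos (2 * κ n * x + φ j n)) +
        blockAmplitude j (-x) * (coupling κ n * Real.cos (2 * κ n * -x + φ j n)) : ℝ) : ℂ)
    else 0 := by
  unfold componentBlock
  split_ifs
  · have e : 2 * κ n * -x + φ j n = -(2 * κ n * x - φ j n) := by ring
    rw [e, Real.cos_neg]
    push_cast
    simp only [Complex.real_smul, Complex.cos, one_mul, neg_mul, mul_neg, neg_neg]
    have e1 : Complex.exp ((2 * κ n * x + φ j n) * Complex.I) =
        Complex.exp (Complex.I * (2 * κ n) * x) * Complex.exp (Complex.I * φ j n) := by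
      rw [← Complex.exp_add]; congr 1; ring
    have e2 : Complex.exp (-((2 * κ n * x + φ j n) * Complex.I)) =
        Complex.exp (-(Complex.I * (2 * κ n) * x)) * Complex.exp (-(Complex.I * φ j n)) := by
      rw [← Complex.exp_add]; congr 1; ring
    have e3 : Complex.exp ((2 * κ n * x - φ j n) * Complex.I) =
        Complex.exp (Complex.I * (2 * κ n) * x) * Complex.exp (-(Complex.I * φ j n)) := by
      rw [← Complex.exp_add]; congr 1; ring
    have e4 : Complex.exp (-((2 * κ n * x - φ j n) * Complex.I)) =
        Complex.exp (-(Complex.I * (2 * κ n) * x)) * Complex.exp (Complex.I * φ j n) := by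
      rw [← Complex.exp_add]; congr 1; ring
    rw [e1, e2, e3, e4]
    ring
  · simp

theorem exists_hasSum_component (x : ℝ) : ∃ a b : ℂ,
    HasSum (fun n => Complex.exp (Complex.I * ((2 * κ n : ℝ) : ℂ) * x) *
      component κ K φ 1 n x) a ∧
    HasSum (fun n => Complex.exp (Complex.I * ((-(2 * κ n) : ℝ) : ℂ) * x) *
      component κ K φ (-1) n x) b ∧ a + b = (blockSumPotential κ K φ x : ℂ) := by
  obtain ⟨N, hN⟩ := exists_abs_lt_four_pow x
  refine ⟨_, _, hasSum_sum_of_ne_finset_zero (s := Finset.range N) fun n hn => ?_,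
    hasSum_sum_of_ne_finset_zero (s := Finset.range N) fun n hn => ?_, ?_⟩
  · rw [component_eq_zero hN (by simpa using hn), mul_zero]
  · rw [component_eq_zero hN (by simpa using hn), mul_zero]
  · rw [← Finset.sum_add_distrib, blockSumPotential,
      tsum_block_eq_sum blockPotential_add_neg_eq_zero hN, Complex.ofReal_sum]
    simp_rw [component_eq_sum hN, Finset.mul_sum, ← Finset.sum_add_distrib,
      exp_mul_componentBlock_add]
    rw [Finset.sum_comm]
    refine Finset.sum_congr rfl fun j hj => ?_
    have hsub : activeSet K j ⊆ Finset.range N := fun n hn =>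
      Finset.mem_range.2 ((Finset.mem_range.1 (Finset.mem_filter.1 hn).1).trans
        (Finset.mem_range.1 hj))
    rw [Finset.sum_ite_mem, Finset.inter_eq_right.2 hsub, ← Complex.ofReal_sum,
      Finset.sum_add_distrib, ← Finset.mul_sum, ← Finset.mul_sum]
    rfl

end Component

/-- Exponential smallness in `K` absorbs every power of the frequency. -/
theorem exists_mul_half_pow_le (N : ℕ) :
    ∃ C : ℝ, 0 < C ∧ ∀ K : ℕ, (K : ℝ) * (1 / 2) ^ K * (1 + 2 * K) ^ N ≤ C := by
  obtain ⟨C, hC⟩ := (tendsto_pow_const_div_const_pow_of_one_lt (N + 1)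
    (by norm_num : (1 : ℝ) < 2)).bddAbove_range
  have hC0 : 0 ≤ C := le_trans (by positivity) (hC ⟨0, rfl⟩)
  refine ⟨3 ^ N * C + 1, by positivity, fun K => ?_⟩
  rcases Nat.eq_zero_or_pos K with rfl | hK
  · simp only [Nat.cast_zero, zero_mul]
    positivity
  have hK1 : (1 : ℝ) ≤ K := by exact_mod_cast hK
  have hCK : (K : ℝ) ^ (N + 1) / 2 ^ K ≤ C := hC ⟨K, rfl⟩
  calc (K : ℝ) * (1 / 2) ^ K * (1 + 2 * K) ^ N ≤ (K : ℝ) * (1 / 2) ^ K * (3 * K) ^ N := by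
        gcongr
        linarith
    _ = 3 ^ N * ((K : ℝ) ^ (N + 1) / 2 ^ K) := by
        rw [one_div, inv_pow, mul_pow, pow_succ]
        ring
    _ ≤ 3 ^ N * C + 1 := by
        have : 3 ^ N * ((K : ℝ) ^ (N + 1) / 2 ^ K) ≤ 3 ^ N * C := by gcongr
        linarith

/-- The potential has frequencies `± 2 κₙ`. Its coefficients start at distance `4 ^ K n` from the
origin and are therefore exponentially small in `K n`. -/
theorem isAlmostPeriodicCoefficient_blockSumPotential {d : ℕ} {ω : EuclideanSpace ℝ (Fin d)}
    {κ : ℕ → ℝ} {K : ℕ → ℕ} (h : IsDelay κ K) (hfreq : ∀ n, 2 * κ n ∈ frequencySet ω)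
    (hfreq' : ∀ n, -(2 * κ n) ∈ frequencySet ω)
    (hK : ∀ n l, |frequency ω l| = 2 * κ n → ‖latticePoint l‖ ≤ K n) (φ : ℕ → ℕ → ℝ) :
    IsAlmostPeriodicCoefficient ω (blockSumPotential κ K φ) := by
  let g : ℕ ⊕ ℕ → frequencySet ω := Sum.elim (fun n => ⟨_, hfreq n⟩) (fun n => ⟨_, hfreq' n⟩)
  have hg : Function.Injective g := by
    have hp := h.pos
    rintro (m | m) (n | n) hmn
    · have : 2 * κ m = 2 * κ n := congrArg Subtype.val hmn
      rw [h.injective (by linarith : κ m = κ n)]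
    · have : 2 * κ m = -(2 * κ n) := congrArg Subtype.val hmn
      linarith [hp m, hp n]
    · have : -(2 * κ m) = 2 * κ n := congrArg Subtype.val hmn
      linarith [hp m, hp n]
    · have : -(2 * κ m) = -(2 * κ n) := congrArg Subtype.val hmn
      rw [h.injective (by linarith : κ m = κ n)]
  let w₀ : ℕ ⊕ ℕ → ℝ → ℂ := Sum.elim (component κ K φ 1) (component κ K φ (-1))
  let w : frequencySet ω → ℝ → ℂ := Function.extend g w₀ 0
  have hwg : ∀ s, w (g s) = w₀ s := hg.extend_apply w₀ 0
  have hw0 : ∀ θ, (∀ s, g s ≠ θ) → w θ = 0 := fun θ hθ =>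
    Function.extend_apply' w₀ (0 : frequencySet ω → ℝ → ℂ) θ fun ⟨s, hs⟩ => hθ s hs
  -- every coefficient vanishes or is one of the components
  have hcases : ∀ θ, w θ = 0 ∨ ∃ σ n, |(θ : ℝ)| = 2 * κ n ∧ w θ = component κ K φ σ n := by
    intro θ
    by_cases hθ : ∃ s, g s = θ
    · right
      obtain ⟨n | n, rfl⟩ := hθ
      · exact ⟨1, n, abs_of_pos (mul_pos two_pos (h.pos n)), hwg _⟩
      · refine ⟨-1, n, ?_, hwg _⟩
        change |-(2 * κ n)| = 2 * κ n
        rw [abs_neg, abs_of_pos (by linarith [h.pos n])]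
    · push Not at hθ
      exact Or.inl (hw0 θ hθ)
  have hbound : ∀ k N : ℕ, ∃ C > 0, ∀ (θ : frequencySet ω) (r x : ℝ), 0 < r →
      (∀ n, |(θ : ℝ)| = 2 * κ n → r ≤ 1 + 2 * K n) →
      ‖iteratedDeriv k (w θ) x‖ ≤ C / (japaneseBracket x ^ k * r ^ N) := by
    intro k N
    obtain ⟨B, hB0, hB⟩ := exists_norm_iteratedDeriv_component_le (φ := φ) h k
    obtain ⟨D, hD0, hD⟩ := exists_mul_half_pow_le N
    refine ⟨B * D + 1, by positivity, fun θ r x hr hrK => ?_⟩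
    have hjb := japaneseBracket_pos x
    rcases hcases θ with h0 | ⟨σ, n, hn, h1⟩
    · have : iteratedDeriv k (0 : ℝ → ℂ) x = 0 := by
        simp [iteratedDeriv_const (c := (0 : ℂ)), show (0 : ℝ → ℂ) = fun _ => 0 from rfl]
      rw [h0, this, norm_zero]
      positivity
    · rw [h1]
      refine (hB σ n x).trans ?_
      rw [← div_div, div_right_comm]
      gcongr
      rw [le_div_iff₀ (by positivity)]
      calc B * (K n * (1 / 2) ^ K n) * r ^ N
          ≤ B * (K n * (1 / 2) ^ K n) * (1 + 2 * K n) ^ N := by gcongr; exact hrK n hn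
        _ = B * (K n * (1 / 2) ^ K n * (1 + 2 * K n) ^ N) := by ring
        _ ≤ B * D + 1 := by
          have := mul_le_mul_of_nonneg_left (hD (K n)) hB0
          linarith
  refine ⟨contDiff_blockSumPotential, w, ⟨fun θ => ?_, fun x => ?_, fun k N => ?_⟩, fun k N => ?_⟩
  · rcases hcases θ with h0 | ⟨σ, n, -, h1⟩
    · rw [h0]
      exact contDiff_const
    · rw [h1]
      exact contDiff_component
  · obtain ⟨a, b, ha, hb, hab⟩ := exists_hasSum_component (κ := κ) (K := K) (φ := φ) x
    rw [← hg.hasSum_iff fun θ hθ => by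
      rw [hw0 θ fun s hs => hθ ⟨s, hs⟩, Pi.zero_apply, mul_zero], ← hab]
    refine HasSum.sum (ha.congr_fun ?_) (hb.congr_fun ?_)
    all_goals
      intro n
      simp only [Function.comp_apply, hwg]
      rfl
  · obtain ⟨C, hC, hCb⟩ := hbound k N
    refine ⟨C, hC, fun θ x => hCb θ _ x (japaneseBracket_pos _) fun n hn => ?_⟩
    have := japaneseBracket_le (θ : ℝ)
    rw [Real.norm_eq_abs, hn] at this
    linarith [h.le n]
  · obtain ⟨C, hC, hCb⟩ := hbound k N
    refine ⟨C, hC, fun l x => hCb _ _ x (japaneseBracket_pos _) fun n hn => ?_⟩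
    have := japaneseBracket_le (latticePoint l)
    have h0 : (0 : ℝ) ≤ K n := Nat.cast_nonneg _
    linarith [hK n l hn]

/-! ### Decaying solutions are eigenfunctions -/

theorem L2R.norm_sq_eq_integral (u : L2R) : ‖u‖ ^ 2 = ∫ x, ‖u x‖ ^ 2 := by
  have h1 : (inner ℂ u u : ℂ) = ((‖u‖ ^ 2 : ℝ) : ℂ) := by
    rw [inner_self_eq_norm_sq_to_K]
    norm_cast
  have h2 : (inner ℂ u u : ℂ) = ((∫ x, ‖u x‖ ^ 2 : ℝ) : ℂ) := by
    rw [L2.inner_def, ← integral_complex_ofReal]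
    refine integral_congr_ae (ae_of_all _ fun x => ?_)
    simp only [inner_self_eq_norm_sq_to_K]
    norm_cast
  exact_mod_cast h1.symm.trans h2

/-- Decay of the Prüfer amplitude at the rate `1 / (1 + x²)` makes the solution square
integrable. -/
theorem IsPruferAngle.mem_pointSpectrum {V : ℝ → ℝ} (hV : Continuous V) {M : ℝ}
    (hM : ∀ x, |V x| ≤ M) {κ : ℝ} (hκ : κ ≠ 0) {θ : ℝ → ℝ} (hθ : IsPruferAngle V κ θ) {C : ℝ}
    (hC : ∀ x, Real.exp (logAmplitude V κ θ x) ≤ C / (1 + x ^ 2)) :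
    ((κ ^ 2 : ℝ) : ℂ) ∈ pointSpectrum (schrodingerOperator V) := by
  set f : ℝ → ℂ := fun x => (pruferSolution V κ θ x : ℂ) with hf
  have d0 : ∀ x, HasDerivAt f (pruferDerivative V κ θ x : ℂ) x := fun x =>
    (hθ.hasDerivAt_pruferSolution hV hκ x).ofReal_comp
  have d1 : ∀ x, HasDerivAt (fun x => (pruferDerivative V κ θ x : ℂ))
      (((V x - κ ^ 2) * pruferSolution V κ θ x : ℝ) : ℂ) x := fun x =>
    (hθ.hasDerivAt_pruferDerivative hV hκ x).ofReal_comp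
  have cf : Continuous f := continuous_iff_continuousAt.2 fun x => (d0 x).continuousAt
  have hC0 : 0 ≤ C := by
    have := (Real.exp_pos _).le.trans (hC 0)
    simpa using this
  have hM0 : 0 ≤ M := (abs_nonneg _).trans (hM 0)
  have hexp : ∀ x, Real.exp (logAmplitude V κ θ x) ≤ C := fun x =>
    (hC x).trans (div_le_self hC0 (by nlinarith [sq_nonneg x]))
  have b0' : ∀ x, ‖f x‖ ≤ Real.exp (logAmplitude V κ θ x) := fun x => by
    rw [hf, Complex.norm_real, pruferSolution, norm_mul, Real.norm_eq_abs, Real.norm_eq_abs,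
      Real.abs_exp]
    exact mul_le_of_le_one_right (Real.exp_pos _).le (Real.abs_sin_le_one _)
  have b0 : ∀ x, ‖f x‖ ≤ C := fun x => (b0' x).trans (hexp x)
  have b1 : ∀ x, ‖(pruferDerivative V κ θ x : ℂ)‖ ≤ |κ| * C := fun x => by
    rw [Complex.norm_real, pruferDerivative, norm_mul, norm_mul, Real.norm_eq_abs, Real.norm_eq_abs,
      Real.norm_eq_abs, Real.abs_exp]
    gcongr
    exact (mul_le_of_le_one_right (Real.exp_pos _).le (Real.abs_cos_le_one _)).trans (hexp x)
  have b2' : ∀ x, ‖(((V x - κ ^ 2) * pruferSolution V κ θ x : ℝ) : ℂ)‖ ≤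
      (M + κ ^ 2) * ‖f x‖ := fun x => by
    rw [Complex.ofReal_mul, norm_mul, Complex.norm_real, Real.norm_eq_abs]
    gcongr
    refine (abs_sub _ _).trans ?_
    rw [abs_of_nonneg (sq_nonneg κ)]
    linarith [hM x]
  have b2 : ∀ x, ‖(((V x - κ ^ 2) * pruferSolution V κ θ x : ℝ) : ℂ)‖ ≤ (M + κ ^ 2) * C :=
    fun x => (b2' x).trans (by gcongr; exact b0 x)
  have hL : MemLp f 2 volume := by
    rw [memLp_two_iff_integrable_sq_norm cf.aestronglyMeasurable]
    refine Integrable.mono' ((integrable_inv_one_add_sq).const_mul (C * C))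
      (by fun_prop) (ae_of_all _ fun x => ?_)
    rw [Real.norm_eq_abs, abs_of_nonneg (sq_nonneg _)]
    calc ‖f x‖ ^ 2 = ‖f x‖ * ‖f x‖ := sq _
      _ ≤ C * (C / (1 + x ^ 2)) :=
        mul_le_mul (b0 x) ((b0' x).trans (hC x)) (norm_nonneg _) hC0
      _ = C * C * (1 + x ^ 2)⁻¹ := by ring
  have cf'' : Continuous fun x => (((V x - κ ^ 2) * pruferSolution V κ θ x : ℝ) : ℂ) := by
    simp_rw [Complex.ofReal_mul]
    exact (Complex.continuous_ofReal.comp (hV.sub continuous_const)).mul cf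
  have hL'' : MemLp (fun x => (((V x - κ ^ 2) * pruferSolution V κ θ x : ℝ) : ℂ)) 2 volume :=
    MemLp.of_le_mul hL cf''.aestronglyMeasurable (ae_of_all _ b2')
  set D := max C (max (|κ| * C) ((M + κ ^ 2) * C))
  obtain ⟨u, hu, hTu⟩ := exists_schrodingerOperator_eq hV hM d0 d1 (C := D)
    (fun x => (b0 x).trans (le_max_left _ _))
    (fun x => (b1 x).trans ((le_max_left _ _).trans (le_max_right _ _)))
    (fun x => (b2 x).trans ((le_max_right _ _).trans (le_max_right _ _))) hL hL''
  refine ⟨u, fun h0 => ?_, ?_⟩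
  · have hae : f =ᵐ[volume] fun _ => (0 : ℂ) := by
      rw [hu] at h0
      have h2 := hL.coeFn_toLp
      rw [h0] at h2
      exact h2.symm.trans (Lp.coeFn_zero ℂ 2 volume)
    have hzero : f = fun _ => (0 : ℂ) :=
      (cf.ae_eq_iff_eq (volume : Measure ℝ) continuous_const).1 hae
    have h1 := d0 0
    rw [hzero] at h1
    have h2 := h1.unique (hasDerivAt_const (0 : ℝ) (0 : ℂ))
    have h3 : pruferDerivative V κ θ 0 = κ := by
      simp [pruferDerivative, logAmplitude, hθ.zero]
    rw [h3] at h2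
    exact hκ (by exact_mod_cast h2)
  · refine Lp.ext (hTu.trans ?_)
    filter_upwards [Lp.coeFn_smul ((κ ^ 2 : ℝ) : ℂ) (u : L2R), hL.coeFn_toLp] with x h1 h2
    rw [h1, Pi.smul_apply, hu, h2, hf]
    simp only [smul_eq_mul]
    push_cast
    ring

/-! ### The essential spectrum -/

theorem blockBump_eq_zero_of_notMem {x : ℝ} (hx : x ∉ Set.Icc (1 : ℝ) 2) :
    blockBump x = 0 ∧ deriv blockBump x = 0 ∧ deriv (deriv blockBump) x = 0 := by
  have ht : tsupport blockBump = Set.Icc (1 : ℝ) 2 := by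
    rw [blockBump.tsupport_eq, Real.closedBall_eq_Icc]
    norm_num [blockBump]
  have h1 : Function.support (deriv blockBump) ⊆ Set.Icc (1 : ℝ) 2 :=
    ht ▸ support_deriv_subset
  have h2 : Function.support (deriv (deriv blockBump)) ⊆ Set.Icc (1 : ℝ) 2 :=
    support_deriv_subset.trans (closure_minimal h1 isClosed_Icc)
  exact ⟨image_eq_zero_of_notMem_tsupport (ht ▸ hx), Function.notMem_support.1 fun h => hx (h1 h),
    Function.notMem_support.1 fun h => hx (h2 h)⟩

/-- A plane wave of energy `κ²`, cut off smoothly to the interval `[L, 2L]`. -/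
noncomputable def wavePacket (s κ L : ℝ) (x : ℝ) : ℂ :=
  (s / √L * blockBump (x / L) : ℝ) * Complex.exp (Complex.I * (κ * x : ℝ))

section WavePacket

variable {s κ L : ℝ}

theorem wavePacket_eq_zero (hL : 0 < L) {x : ℝ} (hx : x ∉ Set.Icc L (2 * L)) :
    wavePacket s κ L x = 0 := by
  have : x / L ∉ Set.Icc (1 : ℝ) 2 := by rwa [Set.mem_Icc, le_div_iff₀ hL, div_le_iff₀ hL, one_mul]
  rw [wavePacket, (blockBump_eq_zero_of_notMem this).1]
  simp

/-- A wave packet is smooth with compact support, and it satisfies the free equation up to an error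
of relative size `1 / L`. -/
theorem wavePacket_properties (hL : 1 ≤ L) {B : ℝ} (hB1 : ∀ x, |deriv blockBump x| ≤ B)
    (hB2 : ∀ x, |deriv (deriv blockBump) x| ≤ B) : ∃ (f' f'' : ℝ → ℂ) (C : ℝ),
      (∀ x, HasDerivAt (wavePacket s κ L) (f' x) x) ∧ (∀ x, HasDerivAt f' (f'' x) x) ∧
      (∀ x, ‖wavePacket s κ L x‖ ≤ C) ∧ (∀ x, ‖f' x‖ ≤ C) ∧ (∀ x, ‖f'' x‖ ≤ C) ∧
      MemLp (wavePacket s κ L) 2 volume ∧ MemLp f'' 2 volume ∧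
      (∀ x ∉ Set.Icc L (2 * L), f'' x = 0) ∧
      ∀ x, ‖f'' x + (κ ^ 2 : ℝ) * wavePacket s κ L x‖ ≤
        |s| / √L * ((1 + 2 * |κ|) * B / L) := by
  have hL0 : 0 < L := one_pos.trans_le hL
  have hB : 0 ≤ B := (abs_nonneg _).trans (hB1 0)
  have cb2 : ContDiff ℝ 2 blockBump := blockBump.contDiff
  have cb1 : ContDiff ℝ 1 (deriv blockBump) := by
    have : ContDiff ℝ (1 + 1) blockBump := by rw [one_add_one_eq_two]; exact cb2
    exact this.deriv'
  have c2 : Continuous (deriv (deriv blockBump)) := cb1.continuous_deriv le_rfl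
  have c1 : Continuous (deriv blockBump) := cb1.continuous
  have c0 : Continuous blockBump := cb2.continuous
  set t := s / √L with ht
  let e : ℝ → ℂ := fun x => Complex.exp (Complex.I * (κ * x : ℝ))
  have ne : ∀ x, ‖e x‖ = 1 := fun x => Complex.norm_exp_I_mul_ofReal _
  have ce : Continuous e := by fun_prop
  have de : ∀ x, HasDerivAt e (Complex.I * κ * e x) x := fun x => by
    have h1 := (((hasDerivAt_id x).const_mul κ).ofReal_comp.const_mul Complex.I).cexp
    refine h1.congr_deriv ?_
    simp only [e, id, mul_one]
    ring
  let A0 : ℝ → ℂ := fun x => (t * blockBump (x / L) : ℝ)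
  let A1 : ℝ → ℂ := fun x => (t * (deriv blockBump (x / L) / L) : ℝ)
  let A2 : ℝ → ℂ := fun x => (t * (deriv (deriv blockBump) (x / L) / L / L) : ℝ)
  have dA0 : ∀ x, HasDerivAt A0 (A1 x) x := fun x => by
    have h1 : HasDerivAt blockBump (deriv blockBump (x / L)) (x / L) :=
      (cb2.differentiable (by norm_num) _).hasDerivAt
    refine (((h1.comp x ((hasDerivAt_id x).div_const L)).const_mul t).congr_deriv
      (g' := t * (deriv blockBump (x / L) / L)) ?_).ofReal_comp
    rw [mul_one_div]
  have dA1 : ∀ x, HasDerivAt A1 (A2 x) x := fun x => by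
    have h1 : HasDerivAt (deriv blockBump) (deriv (deriv blockBump) (x / L)) (x / L) :=
      (cb1.differentiable (by norm_num) _).hasDerivAt
    refine ((((h1.comp x ((hasDerivAt_id x).div_const L)).div_const L).const_mul t).congr_deriv
      (g' := t * (deriv (deriv blockBump) (x / L) / L / L)) ?_).ofReal_comp
    rw [mul_one_div]
  have hout : ∀ x ∉ Set.Icc L (2 * L), A0 x = 0 ∧ A1 x = 0 ∧ A2 x = 0 := fun x hx => by
    have : x / L ∉ Set.Icc (1 : ℝ) 2 := by
      rwa [Set.mem_Icc, le_div_iff₀ hL0, div_le_iff₀ hL0, one_mul]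
    obtain ⟨h0, h1, h2⟩ := blockBump_eq_zero_of_notMem this
    simp [A0, A1, A2, h0, h1, h2]
  have cA0 : Continuous A0 := by fun_prop
  have cA1 : Continuous A1 := by fun_prop
  have cA2 : Continuous A2 := by fun_prop
  set f' : ℝ → ℂ := fun x => A1 x * e x + A0 x * (Complex.I * κ * e x) with hf'
  set f'' : ℝ → ℂ := fun x => (A2 x * e x + A1 x * (Complex.I * κ * e x)) +
    (A1 x * (Complex.I * κ * e x) + A0 x * (Complex.I * κ * (Complex.I * κ * e x))) with hf''
  have s0 : HasCompactSupport (wavePacket s κ L) :=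
    HasCompactSupport.intro isCompact_Icc fun x hx => wavePacket_eq_zero hL0 hx
  have s1 : HasCompactSupport f' :=
    HasCompactSupport.intro (isCompact_Icc (a := L) (b := 2 * L)) fun x hx => by
      obtain ⟨h0, h1, -⟩ := hout x hx
      simp [hf', h0, h1]
  have z2 : ∀ x ∉ Set.Icc L (2 * L), f'' x = 0 := fun x hx => by
    obtain ⟨h0, h1, h2⟩ := hout x hx
    simp [hf'', h0, h1, h2]
  have s2 : HasCompactSupport f'' := HasCompactSupport.intro isCompact_Icc z2
  have k0 : Continuous (wavePacket s κ L) := cA0.mul ce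
  have k1 : Continuous f' := by fun_prop
  have k2 : Continuous f'' := by fun_prop
  obtain ⟨C0, hC0⟩ := s0.exists_bound_of_continuous k0
  obtain ⟨C1, hC1⟩ := s1.exists_bound_of_continuous k1
  obtain ⟨C2, hC2⟩ := s2.exists_bound_of_continuous k2
  refine ⟨f', f'', max C0 (max C1 C2), fun x => (dA0 x).mul (de x),
    fun x => ((dA1 x).mul (de x)).add ((dA0 x).mul ((de x).const_mul _)),
    fun x => (hC0 x).trans (le_max_left _ _),
    fun x => (hC1 x).trans ((le_max_left _ _).trans (le_max_right _ _)),
    fun x => (hC2 x).trans ((le_max_right _ _).trans (le_max_right _ _)),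
    k0.memLp_of_hasCompactSupport s0, k2.memLp_of_hasCompactSupport s2, z2, fun x => ?_⟩
  have heq : f'' x + (κ ^ 2 : ℝ) * wavePacket s κ L x =
      (A2 x + 2 * Complex.I * κ * A1 x) * e x := by
    have : wavePacket s κ L x = A0 x * e x := rfl
    rw [this, hf'']
    push_cast
    linear_combination (κ ^ 2 * A0 x * e x) * Complex.I_sq
  have hA1 : ‖A1 x‖ ≤ |t| * (B / L) := by
    rw [Complex.norm_real, Real.norm_eq_abs, abs_mul, abs_div _ L, abs_of_pos hL0]
    gcongr
    exact hB1 _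
  have hA2 : ‖A2 x‖ ≤ |t| * (B / L) := by
    rw [Complex.norm_real, Real.norm_eq_abs, abs_mul, abs_div _ L, abs_div _ L, abs_of_pos hL0]
    gcongr
    exact (div_le_self (abs_nonneg _) hL).trans (hB2 _)
  have ht' : |t| = |s| / √L := by rw [ht, abs_div, abs_of_nonneg (Real.sqrt_nonneg L)]
  rw [heq, norm_mul, ne, mul_one, ← ht']
  refine (norm_add_le _ _).trans ?_
  have hκ : ‖(κ : ℂ)‖ = |κ| := Complex.norm_real κ
  rw [norm_mul, norm_mul, norm_mul, Complex.norm_I, hκ]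
  calc ‖A2 x‖ + ‖(2 : ℂ)‖ * 1 * |κ| * ‖A1 x‖
      ≤ |t| * (B / L) + 2 * 1 * |κ| * (|t| * (B / L)) := by
        rw [Complex.norm_ofNat]
        gcongr
    _ = |t| * ((1 + 2 * |κ|) * B / L) := by ring

end WavePacket

/-- If the potential vanishes on a sequence of intervals of lengths tending to infinity, wave
packets supported there form a singular Weyl sequence at every energy `κ² ≥ 0`. -/
theorem mem_essentialSpectrum_of_gaps {V : ℝ → ℝ} (hV : Continuous V) {M : ℝ}
    (hM : ∀ x, |V x| ≤ M) (hgap : ∀ (j : ℕ), ∀ x ∈ Set.Icc (2 * 4 ^ j) (4 * 4 ^ j), V x = 0)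
    (κ : ℝ) : ((κ ^ 2 : ℝ) : ℂ) ∈ essentialSpectrum (schrodingerOperator V) := by
  obtain ⟨B1, hB1⟩ := exists_bound_iteratedDeriv_blockBump 1
  obtain ⟨B2, hB2⟩ := exists_bound_iteratedDeriv_blockBump 2
  simp only [iteratedDeriv_succ, iteratedDeriv_zero] at hB1 hB2
  set B := max B1 B2
  have hB0 : 0 ≤ B := (abs_nonneg _).trans ((hB1 0).trans (le_max_left _ _))
  have hI : 0 < ∫ x, blockBump x ^ 2 := by
    refine Continuous.integral_pos_of_hasCompactSupport_nonneg_nonzero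
      (blockBump.continuous.pow 2) ?_ (fun x => sq_nonneg _) (x := 3 / 2) ?_
    · exact HasCompactSupport.intro (isCompact_Icc (a := (1 : ℝ)) (b := 2)) fun x hx => by
        rw [(blockBump_eq_zero_of_notMem hx).1]
        norm_num
    · rw [blockBump.one_of_mem_closedBall (Metric.mem_closedBall_self blockBump.rIn_pos.le)]
      norm_num
  set s := (√(∫ x, blockBump x ^ 2))⁻¹ with hs
  let L : ℕ → ℝ := fun j => 2 * 4 ^ j
  have hL : ∀ j, 1 ≤ L j := fun j => by
    have : (1 : ℝ) ≤ 4 ^ j := one_le_pow₀ (by norm_num)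
    simp only [L]
    linarith
  have hL0 : ∀ j, 0 < L j := fun j => one_pos.trans_le (hL j)
  choose f' f'' C h1 h2 h3 h4 h5 h6 h7 h8 h9 using fun j => wavePacket_properties (s := s) (κ := κ)
    (hL j) (fun x => (hB1 x).trans (le_max_left _ _)) (fun x => (hB2 x).trans (le_max_right _ _))
  choose u hu hTu using fun j =>
    exists_schrodingerOperator_eq hV hM (h1 j) (h2 j) (h3 j) (h4 j) (h5 j) (h6 j) (h7 j)
  have hsq : ∀ j x, ‖wavePacket s κ (L j) x‖ ^ 2 = s ^ 2 / L j * blockBump (x / L j) ^ 2 := by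
    intro j x
    rw [wavePacket, norm_mul, Complex.norm_exp_I_mul_ofReal, mul_one, Complex.norm_real,
      Real.norm_eq_abs, sq_abs, mul_pow, div_pow, Real.sq_sqrt (hL0 j).le]
  refine ⟨u, ⟨fun j => ?_, fun i j hij => ?_⟩, ?_⟩
  · have hone : ‖(u j : L2R)‖ ^ 2 = 1 := by
      rw [L2R.norm_sq_eq_integral, hu]
      have : ∫ x, ‖(h6 j).toLp (wavePacket s κ (L j)) x‖ ^ 2 =
          ∫ x, s ^ 2 / L j * blockBump (x / L j) ^ 2 :=
        integral_congr_ae (by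
          filter_upwards [(h6 j).coeFn_toLp] with x hx
          rw [hx, hsq])
      rw [this, integral_const_mul, Measure.integral_comp_div (fun x => blockBump x ^ 2) (L j),
        abs_of_pos (hL0 j), smul_eq_mul, hs, inv_pow, Real.sq_sqrt hI.le]
      have := (hL0 j).ne'
      field_simp
    exact (pow_eq_one_iff_of_nonneg (norm_nonneg _) two_ne_zero).1 hone
  · change (inner ℂ (u i : L2R) (u j : L2R) : ℂ) = 0
    rw [L2.inner_def]
    refine integral_eq_zero_of_ae ?_
    rw [hu, hu]
    filter_upwards [(h6 i).coeFn_toLp, (h6 j).coeFn_toLp] with x hi hj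
    rw [hi, hj, Pi.zero_apply]
    have hdisj : ∀ a b : ℕ, a < b → x ∈ Set.Icc (L a) (2 * L a) → x ∉ Set.Icc (L b) (2 * L b) := by
      intro a b hab ha hb
      have : (4 : ℝ) ^ (a + 1) ≤ 4 ^ b := pow_le_pow_right₀ (by norm_num) hab
      rw [pow_succ] at this
      have h0 : (0 : ℝ) < 4 ^ a := by positivity
      have := ha.2
      have := hb.1
      simp only [L] at *
      linarith
    by_cases hxi : x ∈ Set.Icc (L i) (2 * L i)
    · have hxj : x ∉ Set.Icc (L j) (2 * L j) := fun hxj => by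
        rcases lt_or_gt_of_ne hij with h | h
        · exact hdisj i j h hxi hxj
        · exact hdisj j i h hxj hxi
      rw [wavePacket_eq_zero (hL0 j) hxj, inner_zero_right]
    · rw [wavePacket_eq_zero (hL0 i) hxi, inner_zero_left]
  · have hbound : ∀ j, ‖schrodingerOperator V (u j) - ((κ ^ 2 : ℝ) : ℂ) • (u j : L2R)‖ ≤
        |s| * ((1 + 2 * |κ|) * B) / 2 * (1 / 4) ^ j := by
      intro j
      set D := |s| / √(L j) * ((1 + 2 * |κ|) * B / L j) with hD
      have hae : ⇑(schrodingerOperator V (u j) - ((κ ^ 2 : ℝ) : ℂ) • (u j : L2R)) =ᵐ[volume]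
          fun x => -(f'' j x + (κ ^ 2 : ℝ) * wavePacket s κ (L j) x) := by
        filter_upwards [Lp.coeFn_sub (schrodingerOperator V (u j))
          (((κ ^ 2 : ℝ) : ℂ) • (u j : L2R)), hTu j, Lp.coeFn_smul ((κ ^ 2 : ℝ) : ℂ) (u j : L2R),
          (h6 j).coeFn_toLp] with x e1 e2 e3 e4
        rw [e1, Pi.sub_apply, e2, e3, Pi.smul_apply, hu, e4, smul_eq_mul]
        have hVw : (V x : ℂ) * wavePacket s κ (L j) x = 0 := by
          by_cases hx : x ∈ Set.Icc (L j) (2 * L j)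
          · rw [hgap j x ⟨hx.1, by have := hx.2; simp only [L] at this; linarith⟩]
            simp
          · rw [wavePacket_eq_zero (hL0 j) hx, mul_zero]
        rw [hVw]
        ring
      have hsqle : ‖schrodingerOperator V (u j) - ((κ ^ 2 : ℝ) : ℂ) • (u j : L2R)‖ ^ 2 ≤
          D ^ 2 * L j := by
        rw [L2R.norm_sq_eq_integral]
        have e1 : ∫ x, ‖(schrodingerOperator V (u j) -
            ((κ ^ 2 : ℝ) : ℂ) • (u j : L2R) : L2R) x‖ ^ 2 =
            ∫ x, ‖f'' j x + (κ ^ 2 : ℝ) * wavePacket s κ (L j) x‖ ^ 2 :=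
          integral_congr_ae (by
            filter_upwards [hae] with x hx
            rw [hx, norm_neg])
        have e2 : ∫ x, ‖f'' j x + (κ ^ 2 : ℝ) * wavePacket s κ (L j) x‖ ^ 2 =
            ∫ x in Set.Icc (L j) (2 * L j), ‖f'' j x + (κ ^ 2 : ℝ) * wavePacket s κ (L j) x‖ ^ 2 :=
          (setIntegral_eq_integral_of_forall_compl_eq_zero fun x hx => by
            rw [h8 j x hx, wavePacket_eq_zero (hL0 j) hx]
            simp).symm
        rw [e1, e2]
        have e3 := norm_setIntegral_le_of_norm_le_const (μ := volume)
          (s := Set.Icc (L j) (2 * L j)) (C := D ^ 2)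
          (f := fun x => ‖f'' j x + (κ ^ 2 : ℝ) * wavePacket s κ (L j) x‖ ^ 2)
          (by simp) (fun x _ => by
            rw [Real.norm_eq_abs, abs_of_nonneg (sq_nonneg _)]
            gcongr
            exact h9 j x)
        refine (le_abs_self _).trans (e3.trans_eq ?_)
        rw [Real.volume_real_Icc_of_le (by linarith [hL0 j])]
        ring
      have hD2 : D ^ 2 * L j = (|s| * ((1 + 2 * |κ|) * B) / 2 * (1 / 4) ^ j) ^ 2 := by
        have h0 := (hL0 j).ne'
        have : D ^ 2 = (|s| * ((1 + 2 * |κ|) * B) / L j) ^ 2 / L j := by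
          rw [hD, mul_pow, div_pow, Real.sq_sqrt (hL0 j).le]
          field_simp
        rw [this, div_mul_cancel₀ _ h0]
        simp only [L, one_div, inv_pow]
        field_simp
      rw [hD2] at hsqle
      exact le_of_sq_le_sq hsqle (by positivity)
    refine squeeze_zero (fun j => norm_nonneg _) hbound ?_
    simpa using (tendsto_pow_atTop_nhds_zero_of_lt_one (by norm_num : (0 : ℝ) ≤ 1 / 4)
      (by norm_num)).const_mul (|s| * ((1 + 2 * |κ|) * B) / 2)

/-! ### The frequencies -/

section Frequency

variable {d : ℕ} {ω : EuclideanSpace ℝ (Fin d)}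

theorem frequency_neg (n : Fin d → ℤ) : frequency ω (-n) = -frequency ω n := by
  simp [frequency]

theorem frequency_sub (m n : Fin d → ℤ) :
    frequency ω (m - n) = frequency ω m - frequency ω n := by
  simp [frequency, sub_mul]

theorem norm_latticePoint_neg (n : Fin d → ℤ) : ‖latticePoint (-n)‖ = ‖latticePoint n‖ := by
  have : latticePoint (-n) = -latticePoint n := by
    ext i
    simp [latticePoint]
  rw [this, norm_neg]

theorem IsDiophantine.frequency_ne_zero (hω : IsDiophantine ω) {n : Fin d → ℤ} (hn : n ≠ 0) :
    frequency ω n ≠ 0 := by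
  obtain ⟨c, hc, μ, -, h⟩ := hω
  exact abs_pos.1 (lt_of_le_of_lt (by positivity) (h n hn))

theorem IsDiophantine.frequency_injective (hω : IsDiophantine ω) :
    Function.Injective (frequency ω) := fun m n hmn => by
  by_contra h
  exact hω.frequency_ne_zero (sub_ne_zero.2 h) (by rw [frequency_sub, hmn, sub_self])

/-- Only the finitely many earlier `κₘ` enter the condition on `K n`, so a delay exists, and it can
be taken larger than any prescribed sequence. -/
theorem exists_isDelay {κ : ℕ → ℝ} (hpos : ∀ n, 0 < κ n) (hinj : Function.Injective κ)
    (R : ℕ → ℝ) : ∃ K : ℕ → ℕ, IsDelay κ K ∧ ∀ n, R n ≤ K n := by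
  have hsum : ∀ n, 0 ≤ ∑ m ∈ Finset.range n, 1 / |κ n - κ m| := fun n =>
    Finset.sum_nonneg fun m _ => by positivity
  have hinv : ∀ n, 0 < 1 / κ n := fun n => one_div_pos.2 (hpos n)
  choose K hK using fun n =>
    exists_nat_ge (κ n + 1 / κ n + ∑ m ∈ Finset.range n, 1 / |κ n - κ m| + |R n| + (n + 1))
  have hn : ∀ n : ℕ, (0 : ℝ) ≤ n := fun n => Nat.cast_nonneg n
  refine ⟨K, ⟨hpos, hinj, fun n => ?_, fun n => ?_, fun n => ?_, fun m n hmn => ?_⟩, fun n => ?_⟩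
  · have : (n : ℝ) < K n := by
      linarith [hK n, hpos n, hinv n, hsum n, abs_nonneg (R n)]
    exact_mod_cast this
  · linarith [hK n, hpos n, hinv n, hsum n, abs_nonneg (R n), hn n]
  · linarith [hK n, hpos n, hinv n, hsum n, abs_nonneg (R n), hn n]
  · have := Finset.single_le_sum (f := fun m => 1 / |κ n - κ m|) (fun m _ => by positivity)
      (Finset.mem_range.2 hmn)
    linarith [hK n, hpos n, hinv n, abs_nonneg (R n), hn n]
  · linarith [hK n, hpos n, hinv n, hsum n, le_abs_self (R n), hn n]

/-- The positive multiples of one nonzero frequency give arbitrarily large frequencies. -/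
theorem IsDiophantine.exists_large_frequency (hω : IsDiophantine ω) (hd : 0 < d) :
    ∃ ε > 0, ∀ k : ℕ, ((k : ℝ) + 1) * ε ∈ frequencySet ω := by
  obtain ⟨n, hn⟩ : ∃ n : Fin d → ℤ, n ≠ 0 := by
    refine ⟨Pi.single ⟨0, hd⟩ 1, fun h => ?_⟩
    have := congrFun h ⟨0, hd⟩
    simp at this
  have key : ∀ n : Fin d → ℤ, ∀ k : ℕ, ((k : ℝ) + 1) * frequency ω n ∈ frequencySet ω :=
    fun n k => ⟨((k : ℤ) + 1) • n, by simp [frequency, Finset.mul_sum, mul_assoc]⟩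
  rcases lt_or_gt_of_ne (hω.frequency_ne_zero hn) with h | h
  · exact ⟨frequency ω (-n), by rw [frequency_neg]; exact neg_pos.2 h, key (-n)⟩
  · exact ⟨frequency ω n, h, key n⟩

/-- The halves of the positive frequencies can be enumerated without repetition. -/
theorem IsDiophantine.exists_enumeration (hω : IsDiophantine ω) (hd : 0 < d) :
    ∃ κ : ℕ → ℝ, (∀ n, 0 < κ n) ∧ Function.Injective κ ∧ (∀ n, 2 * κ n ∈ frequencySet ω) ∧
      ∀ θ ∈ frequencySet ω, 0 < θ → ∃ n, θ = 2 * κ n := by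
  let P : Set ℝ := {θ | θ ∈ frequencySet ω ∧ 0 < θ}
  have hcount : Countable P :=
    ((Set.countable_range (frequency ω)).mono fun θ hθ => hθ.1).to_subtype
  obtain ⟨ε, hε, hk⟩ := hω.exists_large_frequency hd
  have hinf : Infinite P := by
    refine Infinite.of_injective (fun k : ℕ => (⟨((k : ℝ) + 1) * ε, hk k, by positivity⟩ : P))
      fun a b hab => ?_
    have : ((a : ℝ) + 1) * ε = ((b : ℝ) + 1) * ε := congrArg Subtype.val hab
    have := mul_right_cancel₀ hε.ne' this
    exact_mod_cast add_right_cancel this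
  obtain ⟨e⟩ := nonempty_equiv_of_countable (α := ℕ) (β := P)
  have h2 : ∀ n, 2 * ((e n : ℝ) / 2) = e n := fun n => by ring
  refine ⟨fun n => (e n : ℝ) / 2, fun n => half_pos (e n).2.2, fun m n hmn => ?_, fun n => ?_,
    fun θ hθ hθ0 => ⟨e.symm ⟨θ, hθ, hθ0⟩, ?_⟩⟩
  · have : (e m : ℝ) = e n := by
      rw [← h2 m, ← h2 n]
      exact congrArg _ hmn
    exact e.injective (Subtype.ext this)
  · rw [h2]
    exact (e n).2.1
  · rw [h2, Equiv.apply_symm_apply]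

end Frequency

theorem theoremB1 {d : ℕ} (ω : EuclideanSpace ℝ (Fin d)) (hω : IsDiophantine ω) :
    ∃ W : ℝ → ℝ, ContDiff ℝ (⊤ : ℕ∞) W ∧
      SatisfiesAlmostPeriodicHypotheses ω 0 W ∧
      (∀ θ ∈ frequencySet ω, θ ≠ 0 →
        ((θ ^ 2 / 4 : ℝ) : ℂ) ∈ pointSpectrum (schrodingerOperator W)) ∧
      (0 < d → ∀ M : ℝ, ∃ E : ℝ, M < E ∧
        (E : ℂ) ∈ embeddedEigenvalues (schrodingerOperator W)) := by
  have hzero := isAlmostPeriodicCoefficient_zero ω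
  rcases Nat.eq_zero_or_pos d with rfl | hd
  · refine ⟨0, contDiff_const, ⟨hω, hzero, hzero⟩, ?_, fun h => absurd h (lt_irrefl 0)⟩
    rintro θ ⟨n, rfl⟩ hθ
    exact absurd (by simp [frequency]) hθ
  obtain ⟨κ, hpos, hinj, hfreq, hsurj⟩ := hω.exists_enumeration hd
  have hneg : ∀ θ ∈ frequencySet ω, -θ ∈ frequencySet ω := by
    rintro _ ⟨l, rfl⟩
    exact ⟨-l, frequency_neg l⟩
  choose l hl using hfreq
  obtain ⟨K, hK, hKl⟩ := exists_isDelay hpos hinj fun n => ‖latticePoint (l n)‖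
  obtain ⟨φ, θ, hθ, hφ⟩ := exists_tuned_phases hK
  have hcont : ContDiff ℝ (⊤ : ℕ∞) (blockSumPotential κ K φ) := contDiff_blockSumPotential
  have hbd : ∀ x, |blockSumPotential κ K φ x| ≤ 16 / bumpMass := abs_blockSumPotential_le hK
  have heig : ∀ η ∈ frequencySet ω, η ≠ 0 →
      ((η ^ 2 / 4 : ℝ) : ℂ) ∈ pointSpectrum (schrodingerOperator (blockSumPotential κ K φ)) := by
    intro η hη hη0
    have habs : |η| ∈ frequencySet ω := by
      rcases abs_choice η with h | h <;> rw [h]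
      exacts [hη, hneg η hη]
    obtain ⟨n, hn⟩ := hsurj _ habs (abs_pos.2 hη0)
    obtain ⟨C, hC⟩ := exists_exp_logAmplitude_le hK hθ hφ n
    have e : η ^ 2 / 4 = κ n ^ 2 := by
      rw [← sq_abs, hn]
      ring
    rw [e]
    exact (hθ n).mem_pointSpectrum hcont.continuous hbd (hpos n).ne' hC
  refine ⟨blockSumPotential κ K φ, hcont, ⟨hω, hzero, ?_⟩, heig, fun _ M => ?_⟩
  · refine isAlmostPeriodicCoefficient_blockSumPotential hK (fun n => ⟨l n, hl n⟩)
      (fun n => hneg _ ⟨l n, hl n⟩) (fun n k hk => ?_) φ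
    -- by injectivity, `± l n` are the only lattice points of frequency `± 2 κₙ`
    have : ‖latticePoint k‖ = ‖latticePoint (l n)‖ := by
      rw [← hl n] at hk
      rcases abs_choice (frequency ω k) with h | h <;> rw [h] at hk
      · rw [hω.frequency_injective hk]
      · rw [← frequency_neg] at hk
        rw [← hω.frequency_injective hk, norm_latticePoint_neg]
    rw [this]
    exact hKl n
  · obtain ⟨ε, hε, hk⟩ := hω.exists_large_frequency hd
    obtain ⟨k, hkM⟩ := exists_nat_ge (4 * |M| / ε ^ 2)
    rw [div_le_iff₀ (by positivity)] at hkM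
    have hk0 : (0 : ℝ) ≤ k := Nat.cast_nonneg k
    refine ⟨(((k : ℝ) + 1) * ε) ^ 2 / 4, ?_, heig _ (hk k) (by positivity), ?_⟩
    · have h1 : 0 < ε ^ 2 := by positivity
      have h2 := le_abs_self M
      have h3 : ((k : ℝ) + 1) ^ 2 * ε ^ 2 = k * ε ^ 2 + (k ^ 2 + k + 1) * ε ^ 2 := by ring
      have h4 : 0 < ((k : ℝ) ^ 2 + k + 1) * ε ^ 2 := by positivity
      rw [mul_pow, h3]
      linarith
    · have e : (((k : ℝ) + 1) * ε) ^ 2 / 4 = (((k : ℝ) + 1) * ε / 2) ^ 2 := by ring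
      rw [e]
      refine mem_essentialSpectrum_of_gaps hcont.continuous hbd (fun j x hx => ?_) _
      have h0 : (0 : ℝ) < 4 ^ j := by positivity
      rw [blockSumPotential_eq_blockPotential (j := j) ⟨by linarith [hx.1], hx.2⟩,
        blockPotential_eq_zero_of_ge hx.1]
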